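/- **Setting.** Let $\mathbb H$ be the quaternions with the Euclidean scalar product of $\mathbb R^4$, $\mathbb S=\{I\in\mathbb H: I^2=-1\}$, $\mathbb S^3=\{a\in\mathbb H:|a|=1\}$, and $e^{\theta I}=\cos\theta+I\sin\theta$ for $I\in\mathbb S$. A function $f$ on an open set $\Omega\subseteq\mathbb H$ is *slice regular* if for every $I\in\mathbb S$ its restriction to $\Omega\cap(\mathbb R+I\mathbb R)$ is continuously differentiable and $\tfrac12\left(\tfrac{\partial}{\partial x}+I\tfrac{\partial}{\partial y}\right)f(x+yI)=0$ there. A *quaternionic torus* is $T=\mathbb H/L$, where $L$ is the additive subgroup generated by four $\mathbb R$-linearly independent quaternions (a rank-4 lattice), with the charts given by the local inverses of the projection $\mathbb H\to\mathbb H/L$. A continuous map between tori is *regular* if its expressions in these charts are slice regular; two tori are *equivalent* if there is a bijection between them that is regular together with its inverse (a biregular diffeomorphism). The group of biregular automorphisms is $$\mathrm{Aut}(T)=\{F:\mathbb H\to\mathbb H \mid F(q)=qa \text{ for some } a\in\mathbb S^3,\ F(L)=L\}$$ under composition; it always contains $\{\pm1\}=\{q\mapsto q,\ q\mapsto -q\}$.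 Given the Gram matrix $S_0$ of a basis of a rank-4 lattice, the Minkowski–Siegel algorithm picks $U\in GL(4,\mathbb Z)$ with rows $u_1,\dots,u_4$ such that $u_1$ minimizes $uS_0{}^tu$ over $u\in\mathbb Z^4\setminus\{0\}$; for $k=2,3,4$, $u_k$ minimizes $uS_0{}^tu$ over all $u$ such that $u_1,\dots,u_{k-1},u$ are the first $k$ rows of a matrix in $GL(4,\mathbb Z)$; and $u_kS_0{}^tu_{k+1}\ge0$ for $k=1,2,3$. The matrices $US_0{}^tU$ so obtained are the *reduced* Gram matrices. A *special basis* is an $\mathbb R$-linearly independent family $\{1,v_2,v_3,v_4\}$ with reduced Gram matrix, and the *fundamental set* is $\mathcal M=\{(v_2,v_3,v_4)\in\mathbb H^3:\{1,v_2,v_3,v_4\}\text{ is a special basis}\}$. A point $(v_2,v_3,v_4)\in\mathcal M$ is *a modulus* of $T$ if $T$ is equivalent to $\mathbb H/(\mathbb Z+\mathbb Zv_2+\mathbb Zv_3+\mathbb Zv_4)$. Write $e_n=e^{\pi i/n}$, $\omega=\frac{-1+i+j+k}{2}$ and, inside $\mathbb S^3$, $2C_n=\langle e_n\rangle$, $2D_{2n}=\langle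 e_n,j\rangle$, $2\mathbb T=\langle i,\omega\rangle$. The torus $T$ is called *cyclic*, *cyclic-dihedral*, *8-dihedral*, *12-dihedral* or *tetrahedral* if $\mathrm{Aut}(T)$ is isomorphic to $2C_3$, $2C_2$, $2D_4$, $2D_6$ or $2\mathbb T$ respectively. **Theorem.** Let $T$ be a quaternionic torus. 1. $\mathrm{Aut}(T)\ne\{\pm1\}$ if and only if $T$ has a modulus in $\mathcal M$ of one of the forms (a) $(I,\alpha_3,\alpha_3I)$ with $I\in\mathbb S$ and $|\alpha_3|\ge1$; (b) $(e^{\pi I/3},\alpha_3,\alpha_3e^{\pi I/3})$ with $I\in\mathbb S$ and $|\alpha_3|\ge1$. 2. $T$ has a modulus of the form (a) if and only if $\mathrm{Aut}(T)$ contains a subgroup isomorphic to $2C_2$, and a modulus of the form (b) if and only if $\mathrm{Aut}(T)$ contains a subgroup isomorphic to $2C_3$. 3. $\mathrm{Aut}(T)\ne\{\pm1\}$ if and only if $T$ is a cyclic, cyclic-dihedral, 8-dihedral, 12-dihedral or tetrahedral torus. -/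

import Mathlib

open scoped Quaternion

noncomputable section

namespace QTorus

/-- The sphere of imaginary units of the quaternions. -/
def imagUnits : Set ℍ := {I | I ^ 2 = -1}

/-- `e^{θ I} = cos θ + I sin θ`, for an imaginary unit `I`. -/
def sliceExp (θ : ℝ) (I : ℍ) : ℍ := (Real.cos θ : ℍ) + Real.sin θ • I

/-! ### Slice regular functions -/

/-- The restriction of `f` to the slice `ℝ + ℝ I`, in the real coordinates `(x, y) ↦ x + y I`. -/
def sliceRestrict (f : ℍ → ℍ) (I : ℍ) : ℝ × ℝ → ℍ := fun p => f ((p.1 : ℍ) + p.2 • I)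

/-- The part of `Ω` on the slice `ℝ + ℝ I`, in the same coordinates. -/
def slicePart (Ω : Set ℍ) (I : ℍ) : Set (ℝ × ℝ) := {p | (p.1 : ℍ) + p.2 • I ∈ Ω}

/-- `f` is slice regular on the open set `Ω`: on every slice it is continuously differentiable and
annihilated by `(1/2) (∂/∂x + I ∂/∂y)`. -/
def SliceRegularOn (f : ℍ → ℍ) (Ω : Set ℍ) : Prop :=
  ∀ I ∈ imagUnits,
    ContDiffOn ℝ 1 (sliceRestrict f I) (slicePart Ω I) ∧
    ∀ p ∈ slicePart Ω I,
      (1 / 2 : ℝ) • (fderiv ℝ (sliceRestrict f I) p (1, 0)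
        + I * fderiv ℝ (sliceRestrict f I) p (0, 1)) = 0

/-! ### Lattices and quaternionic tori -/

/-- The additive subgroup generated by a family of four quaternions. -/
def latticeOf (v : Fin 4 → ℍ) : AddSubgroup ℍ := AddSubgroup.closure (Set.range v)

/-- A rank-4 lattice: generated by four `ℝ`-linearly independent vectors. -/
def IsRankFourLattice (L : AddSubgroup ℍ) : Prop :=
  ∃ v : Fin 4 → ℍ, LinearIndependent ℝ v ∧ L = latticeOf v

/-- Regular maps between the tori `ℍ ⧸ L₁` and `ℍ ⧸ L₂`. The charts of `ℍ ⧸ L` are the inverses of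
the restrictions of the projection `π` to small open sets of `ℍ`; a continuous map is regular if
around any `p`, `q` with `f (π₁ p) = π₂ q` its expression `F = (π₂|V)⁻¹ ∘ f ∘ π₁|U` in such charts is
slice regular. -/
def IsRegularMap {L₁ L₂ : AddSubgroup ℍ} (f : ℍ ⧸ L₁ → ℍ ⧸ L₂) : Prop :=
  Continuous f ∧
  ∀ p q : ℍ, f (QuotientAddGroup.mk p) = QuotientAddGroup.mk q →
    ∃ U V : Set ℍ, ∃ F : ℍ → ℍ,
      IsOpen U ∧ p ∈ U ∧ Set.InjOn (QuotientAddGroup.mk : ℍ → ℍ ⧸ L₁) U ∧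
      IsOpen V ∧ q ∈ V ∧ Set.InjOn (QuotientAddGroup.mk : ℍ → ℍ ⧸ L₂) V ∧
      Set.MapsTo F U V ∧
      (∀ x ∈ U, (QuotientAddGroup.mk (F x) : ℍ ⧸ L₂) = f (QuotientAddGroup.mk x)) ∧
      SliceRegularOn F U

/-- The tori `ℍ ⧸ L₁` and `ℍ ⧸ L₂` are equivalent: there is a biregular diffeomorphism. -/
def EquivalentTori (L₁ L₂ : AddSubgroup ℍ) : Prop :=
  ∃ f : (ℍ ⧸ L₁) ≃ (ℍ ⧸ L₂), IsRegularMap f ∧ IsRegularMap f.symm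

/-- The group `Aut(T)` of biregular automorphisms of `T = ℍ ⧸ L`, as a group of transformations
of `ℍ`: all `F(q) = q a` with `|a| = 1` and `F(L) = L`. -/
def autTorus (L : AddSubgroup ℍ) : Subgroup (Equiv.Perm ℍ) where
  carrier := {F | ∃ a : ℍ, ‖a‖ = 1 ∧ (∀ q, F q = q * a) ∧ F '' (L : Set ℍ) = L}
  mul_mem' := by
    rintro F G ⟨a, ha, hF, hFL⟩ ⟨b, hb, hG, hGL⟩
    refine ⟨b * a, by simp [ha, hb], fun q => by simp [hF, hG, mul_assoc], ?_⟩
    rw [Equiv.Perm.coe_mul, Set.image_comp, hGL, hFL]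
  one_mem' := ⟨1, by simp, fun q => by simp, by simp⟩
  inv_mem' := by
    rintro F ⟨a, ha, hF, hFL⟩
    have ha0 : a ≠ 0 := by
      rintro rfl
      simp at ha
    refine ⟨a⁻¹, by simp [ha], fun q => ?_, ?_⟩
    · rw [Equiv.Perm.inv_eq_iff_eq, hF, inv_mul_cancel_right₀ ha0]
    · conv_lhs => rw [← hFL]
      rw [← Set.image_comp, ← Equiv.Perm.coe_mul, inv_mul_cancel]
      simp

/-- The set `{±1}` of transformations of `ℍ`. -/
def plusMinusOne : Set (Equiv.Perm ℍ) := {1, Equiv.neg ℍ}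

/-! ### Minkowski-Siegel reduction, special bases and the fundamental set -/

/-- The Gram matrix of four quaternions, for the Euclidean scalar product of `ℍ = ℝ⁴`. -/
def gramMatrix (v : Fin 4 → ℍ) : Matrix (Fin 4) (Fin 4) ℝ :=
  Matrix.of fun k l => inner ℝ (v k) (v l)

/-- The bilinear form `u S ᵗw` on integer vectors. -/
def intForm (S : Matrix (Fin 4) (Fin 4) ℝ) (u w : Fin 4 → ℤ) : ℝ :=
  ∑ k, ∑ l, (u k : ℝ) * S k l * (w l : ℝ)

/-- `U` is a possible output of the Minkowski-Siegel reduction algorithm applied to `S`: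
`U ∈ GL(4, ℤ)`, its first row is a non-zero integer vector minimizing `u S ᵗu`, each later row
minimizes `u S ᵗu` among the `u` such that the previous rows followed by `u` are the first rows of
some matrix of `GL(4, ℤ)`, and consecutive rows have non-negative product. -/
def IsReductionOutput (S : Matrix (Fin 4) (Fin 4) ℝ) (U : Matrix (Fin 4) (Fin 4) ℤ) : Prop :=
  IsUnit U.det ∧
  (∀ u : Fin 4 → ℤ, u ≠ 0 → intForm S (U 0) (U 0) ≤ intForm S u u) ∧
  (∀ k : Fin 4, k ≠ 0 → ∀ V : Matrix (Fin 4) (Fin 4) ℤ, IsUnit V.det →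
    (∀ l < k, V l = U l) → intForm S (U k) (U k) ≤ intForm S (V k) (V k)) ∧
  (∀ k : Fin 3, 0 ≤ intForm S (U k.castSucc) (U k.succ))

/-- A reduced Gram matrix: one obtained by the algorithm from the Gram matrix `S₀` of some basis
of a rank-4 lattice, as `U S₀ ᵗU`. -/
def IsReducedGram (R : Matrix (Fin 4) (Fin 4) ℝ) : Prop :=
  ∃ v : Fin 4 → ℍ, LinearIndependent ℝ v ∧
    ∃ U : Matrix (Fin 4) (Fin 4) ℤ, IsReductionOutput (gramMatrix v) U ∧
      R = U.map (Int.cast : ℤ → ℝ) * gramMatrix v * (U.map (Int.cast : ℤ → ℝ)).transpose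

/-- A special basis (of the rank-4 lattice that it generates): a reduced basis starting with 1. -/
def IsSpecialBasis (v : Fin 4 → ℍ) : Prop :=
  LinearIndependent ℝ v ∧ IsReducedGram (gramMatrix v) ∧ v 0 = 1

/-- The fundamental set `ℳ` of quaternionic tori. -/
def fundamentalSet : Set (ℍ × ℍ × ℍ) := {m | IsSpecialBasis ![1, m.1, m.2.1, m.2.2]}

/-- `m ∈ ℳ` is (a representative of) the modulus of the torus `ℍ ⧸ L`. -/
def IsModulus (L : AddSubgroup ℍ) (m : ℍ × ℍ × ℍ) : Prop :=
  m ∈ fundamentalSet ∧ EquivalentTori L (latticeOf ![1, m.1, m.2.1, m.2.2])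

/-! ### Finite groups of unit quaternions -/

/-- The standard unit `i`. -/
def qi : ℍ := ⟨0, 1, 0, 0⟩

/-- The standard unit `j`. -/
def qj : ℍ := ⟨0, 0, 1, 0⟩

/-- The quaternion `ω = (-1 + i + j + k) / 2`. -/
def qomega : ℍ := ⟨-1 / 2, 1 / 2, 1 / 2, 1 / 2⟩

/-- `2C_n`, generated by `e_n = e^{π i / n}`. -/
def twoC (n : ℕ) : Subgroup ℍˣ :=
  Subgroup.closure {u | (u : ℍ) = sliceExp (Real.pi / n) qi}

/-- `2D_{2n}`, generated by `e_n = e^{π i / n}` and `j`. -/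
def twoD (n : ℕ) : Subgroup ℍˣ :=
  Subgroup.closure {u | (u : ℍ) = sliceExp (Real.pi / n) qi ∨ (u : ℍ) = qj}

/-- `2𝕋`, generated by `i` and `ω`. -/
def twoT : Subgroup ℍˣ :=
  Subgroup.closure {u | (u : ℍ) = qi ∨ (u : ℍ) = qomega}

/-- `Aut(ℍ ⧸ L)` contains a subgroup isomorphic to `G`. -/
def AutContains (L : AddSubgroup ℍ) (G : Subgroup ℍˣ) : Prop :=
  ∃ H : Subgroup (Equiv.Perm ℍ), H ≤ autTorus L ∧ Nonempty (H ≃* G)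

/-- `Aut(ℍ ⧸ L)` is isomorphic to `G`. -/
def AutIso (L : AddSubgroup ℍ) (G : Subgroup ℍˣ) : Prop := Nonempty (autTorus L ≃* G)

/-- A cyclic-dihedral torus. -/
def IsCyclicDihedralTorus (L : AddSubgroup ℍ) : Prop := AutIso L (twoC 2)

/-- A cyclic torus. -/
def IsCyclicTorus (L : AddSubgroup ℍ) : Prop := AutIso L (twoC 3)

/-- An 8-dihedral torus: automorphism group `2D_4`. -/
def IsEightDihedralTorus (L : AddSubgroup ℍ) : Prop := AutIso L (twoD 2)

/-- A 12-dihedral torus: automorphism group `2D_6`. -/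
def IsTwelveDihedralTorus (L : AddSubgroup ℍ) : Prop := AutIso L (twoD 3)

/-- A tetrahedral torus. -/
def IsTetrahedralTorus (L : AddSubgroup ℍ) : Prop := AutIso L twoT

/-- The torus `ℍ ⧸ L` has a modulus `(I, α₃, α₃ I) ∈ ℳ` with `I² = -1` and `|α₃| ≥ 1`. -/
def HasHarmonicModulus (L : AddSubgroup ℍ) : Prop :=
  ∃ I ∈ imagUnits, ∃ α₃ : ℍ, 1 ≤ ‖α₃‖ ∧ IsModulus L (I, α₃, α₃ * I)

/-- The torus `ℍ ⧸ L` has a modulus `(e^{πI/3}, α₃, α₃ e^{πI/3}) ∈ ℳ` with `I² = -1` and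
`|α₃| ≥ 1`. -/
def HasEquianharmonicModulus (L : AddSubgroup ℍ) : Prop :=
  ∃ I ∈ imagUnits, ∃ α₃ : ℍ, 1 ≤ ‖α₃‖ ∧
    IsModulus L (sliceExp (Real.pi / 3) I, α₃, α₃ * sliceExp (Real.pi / 3) I)

end QTorus

end

/-!
An equivalence of tori lifts to a continuous map `F : ℍ → ℍ` between the universal coverings. For
every `s` the increment `F (q + s) - F q` is periodic in `q`, hence bounded, and on each slice it is
holomorphic; by Liouville's theorem it is constant, so that `F` is additive up to a constant on each
slice, and the Cauchy-Riemann equation gives `F q = q a + b` (`affine_of_regular`). Equivalent tori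
therefore have lattices that differ by a right multiplication
(`EquivalentTori.exists_eq_mulRightLattice`), and a modulus of one of the two forms, which visibly
has the multiplier `I` or `e^{πI/3}`, gives an automorphism of order 4 or 6.

Conversely, let `u` be a unit quaternion of order 4 or 6 with `L u = L`. After a right
multiplication by the inverse of a shortest vector, the lattice contains `1` as a shortest vector
and is a module over the Gaussian or the Eisenstein integers `ℤ + ℤ a`, with `a` conjugate to `u`.
These are Euclidean with covering constant at most `1/2`, which gives a basis `1, a, α, α a` in
which `α` is shortest outside of `ℤ + ℤ a` (`IsRankFourLattice.exists_generator`). Such a basis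
is reduced in the sense of Minkowski and Siegel (`isReducedGram_of_norm_le`).

If `L u = L`, then `2 Re u` multiplies `L` into itself, so it is an integer. A group of unit
quaternions with half-integral real parts consists of elements of order 1, 2, 3, 4 or 6, and apart
from `±1` there are five such groups that contain `-1`, up to isomorphism
(`IsCrystallographic.classification`). If two pure elements are orthogonal, they can be conjugated
to `i` and `j`, and the group is `2D₄` or `2𝕋`. If not, the axis of an element of order 6 is
orthogonal to all pure elements (`IsCrystallographic.re_mul_eq_zero`), which leaves `2C₂`, `2C₃`
and `2D₆`.
-/

namespace QTorus

/-! ### The standard units -/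

@[simp] theorem qi_re : qi.re = 0 := rfl
@[simp] theorem qi_imI : qi.imI = 1 := rfl
@[simp] theorem qi_imJ : qi.imJ = 0 := rfl
@[simp] theorem qi_imK : qi.imK = 0 := rfl
@[simp] theorem qj_re : qj.re = 0 := rfl
@[simp] theorem qj_imI : qj.imI = 0 := rfl
@[simp] theorem qj_imJ : qj.imJ = 1 := rfl
@[simp] theorem qj_imK : qj.imK = 0 := rfl
@[simp] theorem qomega_re : qomega.re = -1 / 2 := rfl
@[simp] theorem qomega_imI : qomega.imI = 1 / 2 := rfl
@[simp] theorem qomega_imJ : qomega.imJ = 1 / 2 := rfl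
@[simp] theorem qomega_imK : qomega.imK = 1 / 2 := rfl

theorem qi_mul_qi : qi * qi = -1 := by
  ext <;> simp

theorem qj_mul_qj : qj * qj = -1 := by
  ext <;> simp

theorem qi_mul_qj : qi * qj = -(qj * qi) := by
  ext <;> simp

/-! ### Rank-four lattices -/

theorem latticeOf_eq_span (v : Fin 4 → ℍ) :
    latticeOf v = (Submodule.span ℤ (Set.range v)).toAddSubgroup :=
  (Submodule.span_int_eq_addSubgroupClosure _).symm

theorem mem_latticeOf {v : Fin 4 → ℍ} {q : ℍ} :
    q ∈ latticeOf v ↔ ∃ c : Fin 4 → ℤ, ∑ k, (c k : ℝ) • v k = q := by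
  rw [latticeOf_eq_span, Submodule.mem_toAddSubgroup, Submodule.mem_span_range_iff_exists_fun]
  simp only [Int.cast_smul_eq_zsmul]

theorem exists_basis_coe_eq {v : Fin 4 → ℍ} (hv : LinearIndependent ℝ v) :
    ∃ b : Module.Basis (Fin 4) ℝ ℍ, ⇑b = v :=
  ⟨basisOfLinearIndependentOfCardEqFinrank hv (by simp [Quaternion.finrank_eq_four]), by simp⟩

theorem IsRankFourLattice.discreteTopology {L : AddSubgroup ℍ} (hL : IsRankFourLattice L) :
    DiscreteTopology L := by
  obtain ⟨v, hv, rfl⟩ := hL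
  obtain ⟨b, rfl⟩ := exists_basis_coe_eq hv
  rw [latticeOf_eq_span]
  infer_instance

/-- A lattice meets every ball in a finite set. -/
theorem IsRankFourLattice.finite_norm_le {L : AddSubgroup ℍ} (hL : IsRankFourLattice L) (R : ℝ) :
    {q : ℍ | q ∈ L ∧ ‖q‖ ≤ R}.Finite := by
  have := hL.discreteTopology
  have := Metric.finite_isBounded_inter_isClosed (K := Metric.closedBall (0 : ℍ) R)
    (s := (L : Set ℍ)) ⟨this⟩ Metric.isBounded_closedBall AddSubgroup.isClosed_of_discrete
  refine this.subset fun q hq => ⟨?_, hq.1⟩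
  simpa using hq.2

/-- Every quaternion is within bounded distance of a given lattice. -/
theorem IsRankFourLattice.exists_norm_sub_le {L : AddSubgroup ℍ} (hL : IsRankFourLattice L) :
    ∃ R : ℝ, ∀ q : ℍ, ∃ l ∈ L, ‖q - l‖ ≤ R := by
  obtain ⟨v, hv, rfl⟩ := hL
  obtain ⟨b, rfl⟩ := exists_basis_coe_eq hv
  refine ⟨∑ i, ‖b i‖, fun q => ⟨ZSpan.floor b q, ?_, ZSpan.norm_fract_le b q⟩⟩
  rw [latticeOf_eq_span]
  exact (ZSpan.floor b q).2

theorem IsRankFourLattice.exists_pos_le_norm {L : AddSubgroup ℍ} (hL : IsRankFourLattice L) :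
    ∃ r : ℝ, 0 < r ∧ ∀ l ∈ L, l ≠ 0 → r ≤ ‖l‖ := by
  have := hL.discreteTopology
  obtain ⟨r, hr, h⟩ := Metric.isOpen_singleton_iff.1 (isOpen_discrete ({0} : Set L))
  refine ⟨r, hr, fun l hl h0 => ?_⟩
  by_contra! hlt
  exact h0 (congrArg Subtype.val (h ⟨l, hl⟩ (by simpa [Subtype.dist_eq] using hlt)))

/-- A real number whose multiplication preserves a lattice is an integer. -/
theorem IsRankFourLattice.exists_int_eq {L : AddSubgroup ℍ} (hL : IsRankFourLattice L) {t : ℝ}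
    (ht : ∀ q ∈ L, t • q ∈ L) : ∃ n : ℤ, t = n := by
  obtain ⟨v, hv, rfl⟩ := hL
  obtain ⟨c, hc⟩ := mem_latticeOf.1 (ht (v 0) (AddSubgroup.subset_closure ⟨0, rfl⟩))
  refine ⟨c 0, ?_⟩
  have h : ∑ k, ((c k : ℝ) - if k = 0 then t else 0) • v k = 0 := by
    simp [sub_smul, Finset.sum_sub_distrib, hc]
  have := Fintype.linearIndependent_iff.1 hv _ h 0
  simp only [if_true] at this
  linarith

theorem IsRankFourLattice.ne_top {L : AddSubgroup ℍ} (hL : IsRankFourLattice L) :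
    ∃ q : ℍ, q ∉ L := by
  obtain ⟨r, hr, h⟩ := hL.exists_pos_le_norm
  refine ⟨((r / 2 : ℝ) : ℍ), fun hq => ?_⟩
  have h1 := h _ hq (by
    intro h0
    have : r / 2 = 0 := Quaternion.coe_injective (h0.trans Quaternion.coe_zero.symm)
    linarith)
  rw [Quaternion.norm_coe, Real.norm_eq_abs, abs_of_pos (by linarith)] at h1
  linarith

theorem IsRankFourLattice.exists_ne_zero {L : AddSubgroup ℍ} (hL : IsRankFourLattice L) :
    ∃ q ∈ L, q ≠ 0 := by
  obtain ⟨v, hv, rfl⟩ := hL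
  exact ⟨v 0, AddSubgroup.subset_closure ⟨0, rfl⟩, hv.ne_zero 0⟩

/-- The image of a lattice under right multiplication by `a`. -/
def mulRightLattice (L : AddSubgroup ℍ) (a : ℍ) : AddSubgroup ℍ :=
  L.map (AddMonoidHom.mulRight a)

theorem mem_mulRightLattice {L : AddSubgroup ℍ} {a q : ℍ} (ha : a ≠ 0) :
    q ∈ mulRightLattice L a ↔ q * a⁻¹ ∈ L := by
  simp only [mulRightLattice, AddSubgroup.mem_map, AddMonoidHom.coe_mulRight]
  constructor
  · rintro ⟨x, hx, rfl⟩
    rwa [mul_inv_cancel_right₀ ha]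
  · intro h
    exact ⟨_, h, inv_mul_cancel_right₀ ha _⟩

theorem IsRankFourLattice.mulRightLattice {L : AddSubgroup ℍ} (hL : IsRankFourLattice L) {a : ℍ}
    (ha : a ≠ 0) : IsRankFourLattice (mulRightLattice L a) := by
  obtain ⟨v, hv, rfl⟩ := hL
  refine ⟨fun k => v k * a, ?_, ?_⟩
  · have := hv.map' (LinearMap.mulRight ℝ a)
      (LinearMap.ker_eq_bot.2 (mul_left_injective₀ ha))
    exact this
  · rw [QTorus.mulRightLattice, latticeOf, latticeOf, AddMonoidHom.map_closure, ← Set.range_comp]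
    rfl

/-! ### Equivalent tori -/

/-- Liouville's theorem: a bounded map that is holomorphic for left multiplication by `I` is
constant. -/
theorem sliceRestrict_liouville {I : ℍ} (hI : I ∈ imagUnits) {h : ℝ × ℝ → ℍ}
    (hd : Differentiable ℝ h)
    (hCR : ∀ p, fderiv ℝ h p (1, 0) + I * fderiv ℝ h p (0, 1) = 0)
    {C : ℝ} (hC : ∀ p, ‖h p‖ ≤ C) (p p' : ℝ × ℝ) : h p = h p' := by
  have hI2 : I * I = -1 := by rw [← sq]; exact hI
  have hCR' : ∀ p, fderiv ℝ h p (0, 1) = I * fderiv ℝ h p (1, 0) := by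
    intro p
    rw [eq_neg_of_add_eq_zero_left (hCR p), mul_neg, ← mul_assoc, hI2]
    simp
  -- pairing with `w` over the complex structure given by `I` turns `h` into a holomorphic function
  let Λ : ℍ → ℍ →L[ℝ] ℂ := fun w =>
    Complex.ofRealCLM ∘L innerSL ℝ w
      - Complex.I • (Complex.ofRealCLM ∘L innerSL ℝ w ∘L ContinuousLinearMap.mul ℝ ℍ I)
  have hΛ : ∀ w q, Λ w q = (inner ℝ w q : ℂ) - Complex.I * (inner ℝ w (I * q) : ℂ) := by
    intro w q
    simp [Λ]
  have hΛI : ∀ w q, Λ w (I * q) = Complex.I * Λ w q := by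
    intro w q
    rw [hΛ, hΛ, ← mul_assoc, hI2, mul_sub, ← mul_assoc, Complex.I_mul_I]
    simp
    ring
  let e : ℂ →L[ℝ] ℝ × ℝ := Complex.equivRealProdCLM
  have hg : ∀ w, Differentiable ℂ fun z : ℂ => Λ w (h (e z)) := by
    intro w z
    have h1 : HasFDerivAt (fun z : ℂ => Λ w (h (e z))) (Λ w ∘L fderiv ℝ h (e z) ∘L e) z :=
      (Λ w).hasFDerivAt.comp z ((hd _).hasFDerivAt.comp z e.hasFDerivAt)
    rw [differentiableAt_complex_iff_differentiableAt_real]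
    refine ⟨h1.differentiableAt, ?_⟩
    rw [h1.fderiv]
    have e1 : e 1 = (1, 0) := by simp [e]
    have eI : e Complex.I = (0, 1) := by simp [e]
    simp [e1, eI, hCR', hΛI]
  have key : ∀ w z z', Λ w (h (e z)) = Λ w (h (e z')) := by
    intro w z z'
    refine (hg w).apply_eq_apply_of_bounded ?_ z z'
    refine (Metric.isBounded_closedBall (x := (0 : ℂ)) (r := ‖Λ w‖ * C)).subset ?_
    rintro _ ⟨x, rfl⟩
    rw [mem_closedBall_zero_iff]
    exact ((Λ w).le_opNorm _).trans (by gcongr; exact hC _)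
  refine ext_inner_left ℝ fun w => ?_
  have := congrArg Complex.re (key w (Complex.equivRealProdCLM.symm p)
    (Complex.equivRealProdCLM.symm p'))
  simpa [hΛ, e] using this

/-- A continuous slice regular map of `ℍ` that commutes with the translations of a lattice up to
constants is affine: its increments are bounded, hence constant on every slice. -/
theorem affine_of_regular {L : AddSubgroup ℍ} (hL : IsRankFourLattice L) {F : ℍ → ℍ}
    (hF : Continuous F) (hper : ∀ l ∈ L, ∀ q, F (q + l) - F q = F l - F 0)
    (hreg : ∀ I ∈ imagUnits, Differentiable ℝ (sliceRestrict F I) ∧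
      ∀ p, fderiv ℝ (sliceRestrict F I) p (1, 0)
        + I * fderiv ℝ (sliceRestrict F I) p (0, 1) = 0) :
    ∃ a, ∀ q, F q = q * a + F 0 := by
  -- the increments of `F` are periodic and continuous, hence bounded
  have hbdd : ∀ s, ∃ C : ℝ, ∀ q, ‖F (q + s) - F q‖ ≤ C := by
    intro s
    obtain ⟨R, hR⟩ := hL.exists_norm_sub_le
    have hc : Continuous fun q => F (q + s) - F q := by fun_prop
    obtain ⟨C, hC⟩ := (isCompact_closedBall (0 : ℍ) R).exists_bound_of_continuousOn hc.continuousOn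
    refine ⟨C, fun q => ?_⟩
    obtain ⟨l, hl, hql⟩ := hR q
    have h1 := hC (q - l) (by simpa using hql)
    have h2 := hper l hl (q - l)
    have h3 := hper l hl (q - l + s)
    rw [sub_add_cancel] at h2
    rw [show q - l + s + l = q + s by abel] at h3
    have : F (q + s) - F q = F (q - l + s) - F (q - l) := by
      rw [← sub_eq_zero, ← sub_eq_zero.2 (h3.trans h2.symm)]
      abel
    rwa [this]
  have hslice : ∀ I ∈ imagUnits, ∀ x y : ℝ,
      F ((x : ℍ) + y • I) = ((x : ℍ) + y • I) * (F 1 - F 0) + F 0 := by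
    intro I hI
    obtain ⟨hd, hCR⟩ := hreg I hI
    let ι : ℝ × ℝ → ℍ := fun p => (p.1 : ℍ) + p.2 • I
    have hι : ∀ p p', ι (p + p') = ι p + ι p' := by
      intro p p'
      simp only [ι, Prod.fst_add, Prod.snd_add, Quaternion.coe_add, add_smul]
      abel
    have hιc : Continuous ι := by
      have := Quaternion.continuous_coe
      fun_prop
    have hinc : ∀ s p, F (ι (p + s)) - F (ι p) = F (ι s) - F (ι 0) := by
      intro s p
      obtain ⟨C, hC⟩ := hbdd (ι s)
      have hd' : Differentiable ℝ fun p => sliceRestrict F I (p + s) :=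
        hd.comp (differentiable_id.add_const s)
      have := sliceRestrict_liouville hI
        (h := fun p => sliceRestrict F I (p + s) - sliceRestrict F I p) (hd'.sub hd)
        (fun p => by
          rw [fderiv_fun_sub (hd' p) (hd p), fderiv_comp_add_right]
          have h1 := hCR (p + s)
          have h2 := hCR p
          simp only [_root_.sub_apply, mul_sub]
          rw [← sub_eq_zero.2 (h1.trans h2.symm)]
          abel) (C := C)
        (fun p => by
          have := hC (ι p)
          rw [← hι] at this
          exact this) p 0
      simpa [sliceRestrict, ι] using this
    have hι0 : ι 0 = 0 := by simp [ι]
    let A : ℝ × ℝ →+ ℍ :=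
      { toFun := fun p => F (ι p) - F 0
        map_zero' := by simp [hι0]
        map_add' := fun p p' => by
          have := hinc p' p
          rw [hι0] at this
          rw [← this]
          abel }
    let B : ℝ × ℝ →L[ℝ] ℍ := A.toRealLinearMap
      (show Continuous fun p => F (ι p) - F 0 by fun_prop)
    have hB : ∀ p, B p = F (ι p) - F 0 := fun p => rfl
    have hfd : fderiv ℝ (sliceRestrict F I) 0 = B := by
      have : sliceRestrict F I = fun p => B p + F 0 := by
        funext p
        rw [hB, sub_add_cancel]
        rfl
      rw [this]
      exact (B.hasFDerivAt.add_const _).fderiv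
    have h0 := hCR 0
    rw [hfd] at h0
    have hI2 : I * I = -1 := by rw [← sq]; exact hI
    have hB1 : B (1, 0) = F 1 - F 0 := by simp [hB, ι]
    have hB2 : B (0, 1) = I * (F 1 - F 0) := by
      rw [← hB1, eq_neg_of_add_eq_zero_left h0, mul_neg, ← mul_assoc, hI2]
      simp
    intro x y
    have : B (x, y) = x • B (1, 0) + y • B (0, 1) := by
      rw [← map_smul, ← map_smul, ← map_add]
      simp
    rw [hB1, hB2, hB, sub_eq_iff_eq_add] at this
    simp only [ι] at this
    rw [this, add_mul, Quaternion.coe_mul_eq_smul, smul_mul_assoc]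
  refine ⟨F 1 - F 0, fun q => ?_⟩
  -- every quaternion lies on a slice
  obtain ⟨I, hI, x, y, rfl⟩ : ∃ I ∈ imagUnits, ∃ x y : ℝ, q = (x : ℍ) + y • I := by
    by_cases h : q.im = 0
    · refine ⟨qi, (sq qi).trans qi_mul_qi, q.re, 0, ?_⟩
      · rw [zero_smul, ← h, Quaternion.re_add_im]
    · refine ⟨‖q.im‖⁻¹ • q.im, ?_, q.re, ‖q.im‖, ?_⟩
      · have : q.im * q.im = -((‖q.im‖ * ‖q.im‖ : ℝ) : ℍ) := by
          rw [← Quaternion.normSq_eq_norm_mul_self, ← sq, Quaternion.im_sq]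
        have h' : ‖q.im‖ ≠ 0 := norm_ne_zero_iff.2 h
        simp only [imagUnits, Set.mem_ofPred_eq, sq, smul_mul_smul_comm, this]
        rw [smul_neg, ← Quaternion.coe_smul, smul_eq_mul]
        field_simp
        simp
      · rw [smul_smul, mul_inv_cancel₀ (norm_ne_zero_iff.2 h), one_smul, Quaternion.re_add_im]
  exact hslice I hI x y

theorem sliceRegularOn_mul_add (a b : ℍ) (U : Set ℍ) : SliceRegularOn (fun q => q * a + b) U := by
  intro I hI
  have hI2 : I * I = -1 := by rw [← sq]; exact hI
  let B : ℝ × ℝ →L[ℝ] ℍ := (ContinuousLinearMap.fst ℝ ℝ ℝ).smulRight a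
    + (ContinuousLinearMap.snd ℝ ℝ ℝ).smulRight (I * a)
  have hB : sliceRestrict (fun q => q * a + b) I = fun p => B p + b := by
    funext p
    simp [sliceRestrict, B, add_mul, Quaternion.coe_mul_eq_smul]
  rw [hB]
  refine ⟨(B.contDiff.add contDiff_const).contDiffOn, fun p _ => ?_⟩
  rw [(B.hasFDerivAt.add_const _).fderiv]
  simp [B, ← mul_assoc, hI2]

/-- Small balls inject into the torus. -/
theorem injOn_mk_ball {L : AddSubgroup ℍ} {r : ℝ} (h : ∀ l ∈ L, l ≠ 0 → r ≤ ‖l‖) (p : ℍ) :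
    Set.InjOn (QuotientAddGroup.mk : ℍ → ℍ ⧸ L) (Metric.ball p (r / 2)) := by
  intro x hx y hy hxy
  by_contra hne
  have h1 := h _ (QuotientAddGroup.eq.1 hxy) (by
    rw [neg_add_eq_sub]
    exact sub_ne_zero.2 (Ne.symm hne))
  rw [neg_add_eq_sub, ← dist_eq_norm] at h1
  have := dist_triangle_right y x p
  rw [Metric.mem_ball] at hx hy
  linarith

/-- Right multiplications induce regular maps. -/
theorem isRegularMap_map {L₁ L₂ : AddSubgroup ℍ} (h₁ : IsRankFourLattice L₁)
    (h₂ : IsRankFourLattice L₂) {a : ℍ} (ha : L₁ ≤ L₂.comap (AddMonoidHom.mulRight a)) :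
    IsRegularMap (QuotientAddGroup.map L₁ L₂ (AddMonoidHom.mulRight a) ha) := by
  obtain ⟨r₁, hr₁, hL₁⟩ := h₁.exists_pos_le_norm
  obtain ⟨r₂, hr₂, hL₂⟩ := h₂.exists_pos_le_norm
  refine ⟨?_, fun p q hpq => ?_⟩
  · refine (QuotientAddGroup.isQuotientMap_mk L₁).continuous_iff.2 ?_
    exact QuotientAddGroup.continuous_mk.comp (continuous_mul_const a)
  · have hb : q - p * a ∈ L₂ := by
      have : (QuotientAddGroup.mk (p * a) : ℍ ⧸ L₂) = QuotientAddGroup.mk q := hpq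
      rw [QuotientAddGroup.eq] at this
      rwa [sub_eq_neg_add]
    have hc : Continuous fun x : ℍ => x * a + (q - p * a) := by fun_prop
    refine ⟨Metric.ball p (r₁ / 2) ∩ (fun x : ℍ => x * a + (q - p * a)) ⁻¹' Metric.ball q (r₂ / 2),
      Metric.ball q (r₂ / 2), fun x => x * a + (q - p * a),
      Metric.isOpen_ball.inter (Metric.isOpen_ball.preimage hc), ?_,
      (injOn_mk_ball hL₁ p).mono Set.inter_subset_left, Metric.isOpen_ball,
      Metric.mem_ball_self (by linarith), injOn_mk_ball hL₂ q, fun x hx => hx.2, fun x _ => ?_,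
      sliceRegularOn_mul_add _ _ _⟩
    · refine ⟨Metric.mem_ball_self (by linarith), ?_⟩
      simp [hr₂]
    · change (QuotientAddGroup.mk (x * a + (q - p * a)) : ℍ ⧸ L₂) = QuotientAddGroup.mk (x * a)
      rw [QuotientAddGroup.eq]
      simpa using L₂.neg_mem hb

theorem equivalentTori_mulRightLattice {L : AddSubgroup ℍ} (hL : IsRankFourLattice L) {a : ℍ}
    (ha : a ≠ 0) : EquivalentTori L (mulRightLattice L a) := by
  have hL' := hL.mulRightLattice ha
  have h1 : L ≤ (mulRightLattice L a).comap (AddMonoidHom.mulRight a) := fun q hq =>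
    ⟨q, hq, rfl⟩
  have h2 : mulRightLattice L a ≤ L.comap (AddMonoidHom.mulRight a⁻¹) := fun q hq =>
    (mem_mulRightLattice ha).1 hq
  refine ⟨⟨QuotientAddGroup.map _ _ _ h1, QuotientAddGroup.map _ _ _ h2, ?_, ?_⟩,
    isRegularMap_map hL hL' h1, isRegularMap_map hL' hL h2⟩
  · intro x
    induction x using QuotientAddGroup.induction_on with
    | H q => simp [mul_inv_cancel_right₀ ha]
  · intro x
    induction x using QuotientAddGroup.induction_on with
    | H q => simp [inv_mul_cancel_right₀ ha]

/-- Two equivalent tori have lattices that differ by a right multiplication: a biregular map lifts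
to a continuous map of the universal covering `ℍ`, which is affine by `affine_of_regular`. -/
theorem EquivalentTori.exists_eq_mulRightLattice {L₁ L₂ : AddSubgroup ℍ}
    (h₁ : IsRankFourLattice L₁) (h₂ : IsRankFourLattice L₂) (h : EquivalentTori L₁ L₂) :
    ∃ a ≠ 0, L₂ = mulRightLattice L₁ a := by
  obtain ⟨f, ⟨hfc, hf⟩, -⟩ := h
  have hd := h₂.discreteTopology
  have hcov : IsCoveringMap (QuotientAddGroup.mk : ℍ → ℍ ⧸ L₂) :=
    (L₂.isAddQuotientCoveringMap_of_comm ⟨hd⟩).isCoveringMap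
  obtain ⟨b, hb⟩ := QuotientAddGroup.mk_surjective (f (QuotientAddGroup.mk 0))
  obtain ⟨F, ⟨-, hF⟩, -⟩ := hcov.existsUnique_continuousMap_lifts
    ⟨fun q : ℍ => f (QuotientAddGroup.mk q), hfc.comp QuotientAddGroup.continuous_mk⟩ 0 b hb
  replace hF : ∀ q, (QuotientAddGroup.mk (F q) : ℍ ⧸ L₂) = f (QuotientAddGroup.mk q) :=
    fun q => congrFun hF q
  obtain ⟨r₂, hr₂, hL₂⟩ := h₂.exists_pos_le_norm
  have hper : ∀ l ∈ L₁, ∀ q, F (q + l) - F q = F l - F 0 := by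
    intro l hl q
    have hmem : ∀ q, F (q + l) - F q ∈ L₂ := by
      intro q
      rw [sub_eq_neg_add, ← QuotientAddGroup.eq, hF, hF, QuotientAddGroup.mk_add_of_mem _ hl]
    have hcont : Continuous fun q => (⟨F (q + l) - F q, hmem q⟩ : L₂) :=
      Continuous.subtype_mk (by fun_prop) _
    have := PreconnectedSpace.constant inferInstance hcont (x := q) (y := 0)
    simpa using congrArg Subtype.val this
  -- near each point the lift agrees with the expression of `f` in the charts
  have hloc : ∀ p, ∃ U, IsOpen U ∧ p ∈ U ∧ ∃ G, SliceRegularOn G U ∧ Set.EqOn F G U := by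
    intro p
    obtain ⟨U, V, G, hU, hpU, -, hV, hqV, hVi, hmaps, hG, hreg⟩ := hf p (F p) (hF p).symm
    refine ⟨U ∩ F ⁻¹' V, hU.inter (hV.preimage F.continuous), ⟨hpU, hqV⟩, G, ?_, ?_⟩
    · intro I hI
      exact ⟨(hreg I hI).1.mono fun x hx => hx.1, fun x hx => (hreg I hI).2 x hx.1⟩
    · intro x hx
      exact hVi hx.2 (hmaps hx.1) ((hF x).trans (hG x hx.1).symm)
  obtain ⟨a, ha⟩ := affine_of_regular h₁ F.continuous hper (by
    intro I hI
    have key : ∀ p, DifferentiableAt ℝ (sliceRestrict F I) p ∧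
        fderiv ℝ (sliceRestrict F I) p (1, 0) + I * fderiv ℝ (sliceRestrict F I) p (0, 1) = 0 := by
      intro p
      obtain ⟨U, hU, hpU, G, hG, hFG⟩ := hloc ((p.1 : ℍ) + p.2 • I)
      have hUo : IsOpen (slicePart U I) := by
        have hc := Quaternion.continuous_coe
        exact hU.preimage (f := fun p : ℝ × ℝ => (p.1 : ℍ) + p.2 • I) (by fun_prop)
      have hnhds : slicePart U I ∈ nhds p := hUo.mem_nhds hpU
      have hev : sliceRestrict F I =ᶠ[nhds p] sliceRestrict G I := by
        filter_upwards [hnhds] with x hx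
        exact hFG hx
      obtain ⟨hG1, hG2⟩ := hG I hI
      refine ⟨((hG1.contDiffAt hnhds).differentiableAt (by norm_num)).congr_of_eventuallyEq hev, ?_⟩
      rw [hev.fderiv_eq]
      exact (smul_eq_zero.1 (hG2 p hpU)).resolve_left (by norm_num)
    exact ⟨fun p => (key p).1, fun p => (key p).2⟩)
  have hmem : ∀ q, q ∈ L₁ ↔ q * a ∈ L₂ := by
    intro q
    have h1 : (QuotientAddGroup.mk 0 : ℍ ⧸ L₁) = QuotientAddGroup.mk q ↔ q ∈ L₁ := by
      rw [QuotientAddGroup.eq]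
      simp
    rw [← h1, ← f.injective.eq_iff, ← hF, ← hF, QuotientAddGroup.eq, ha q]
    simp
  have ha0 : a ≠ 0 := by
    rintro rfl
    obtain ⟨q, hq⟩ := h₁.ne_top
    exact hq ((hmem q).2 (by simp [L₂.zero_mem]))
  refine ⟨a, ha0, ?_⟩
  ext q
  rw [mem_mulRightLattice ha0, hmem, inv_mul_cancel_right₀ ha0]

/-! ### The group of automorphisms as a group of unit quaternions -/

/-- The group of the unit quaternions `a` with `L a = L`. -/
def unitStabilizer (L : AddSubgroup ℍ) : Subgroup ℍˣ where
  carrier := {u | ‖(u : ℍ)‖ = 1 ∧ ∀ q : ℍ, q * u ∈ L ↔ q ∈ L}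
  mul_mem' := by
    rintro u w ⟨hu, hu'⟩ ⟨hw, hw'⟩
    refine ⟨by simp [hu, hw], fun q => ?_⟩
    rw [Units.val_mul, ← mul_assoc, hw', hu']
  one_mem' := by simp
  inv_mem' := by
    rintro u ⟨hu, hu'⟩
    refine ⟨by simp [hu], fun q => ?_⟩
    rw [← hu', Units.inv_mul_cancel_right]

theorem neg_one_mem_unitStabilizer (L : AddSubgroup ℍ) : -1 ∈ unitStabilizer L :=
  ⟨by simp, fun q => by simp⟩

theorem image_mulRight_eq_iff {L : AddSubgroup ℍ} (u : ℍˣ) :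
    (fun q : ℍ => q * u) '' (L : Set ℍ) = L ↔ ∀ q : ℍ, q * u ∈ L ↔ q ∈ L := by
  constructor
  · intro h q
    rw [← SetLike.mem_coe, ← h]
    constructor
    · rintro ⟨x, hx, hxq⟩
      rwa [← u.isUnit.mul_right_cancel hxq]
    · intro hq
      exact ⟨q, hq, rfl⟩
  · intro h
    ext q
    constructor
    · rintro ⟨x, hx, rfl⟩
      exact (h x).2 hx
    · intro hq
      refine ⟨q * ↑u⁻¹, ?_, by simp⟩
      rw [SetLike.mem_coe, ← h, Units.inv_mul_cancel_right]
      exact hq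

/-- A unit quaternion `u` stabilizing `L` acts by `q ↦ q u⁻¹`; the inverse turns the right
multiplications into a left action, so that this is an isomorphism onto the automorphism group. -/
noncomputable def unitStabilizerEquiv (L : AddSubgroup ℍ) : unitStabilizer L ≃* autTorus L :=
  MulEquiv.ofBijective
    (MonoidHom.mk' (fun u : unitStabilizer L => (⟨Units.mulRight (u : ℍˣ)⁻¹, (((u : ℍˣ)⁻¹ : ℍˣ) : ℍ),
          ((unitStabilizer L).inv_mem u.2).1, fun _ => rfl,
          (image_mulRight_eq_iff _).2 ((unitStabilizer L).inv_mem u.2).2⟩ : autTorus L))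
      fun (u w : unitStabilizer L) => by
        ext q : 2
        simp [mul_assoc])
    (by
      constructor
      · intro u w h
        have h1 : (1 : ℍ) * ↑(u : ℍˣ)⁻¹ = 1 * ↑(w : ℍˣ)⁻¹ :=
          congrArg (fun F : autTorus L => (F : Equiv.Perm ℍ) 1) h
        rw [one_mul, one_mul, Units.val_inj, inv_inj] at h1
        exact Subtype.ext h1
      · rintro ⟨F, a, ha, hF, hFL⟩
        have ha0 : a ≠ 0 := by
          rintro rfl
          simp at ha
        have hFL' : (fun q : ℍ => q * (Units.mk0 a ha0 : ℍˣ)) '' (L : Set ℍ) = L := by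
          rw [show (fun q : ℍ => q * (Units.mk0 a ha0 : ℍˣ)) = F from (funext hF).symm]
          exact hFL
        refine ⟨⟨(Units.mk0 a ha0)⁻¹, (unitStabilizer L).inv_mem
          ⟨ha, (image_mulRight_eq_iff _).1 hFL'⟩⟩, ?_⟩
        ext q : 2
        exact (by simp : q * ((((Units.mk0 a ha0)⁻¹)⁻¹ : ℍˣ) : ℍ) = q * a).trans (hF q).symm)

theorem unitStabilizerEquiv_apply (L : AddSubgroup ℍ) (u : unitStabilizer L) (q : ℍ) :
    (unitStabilizerEquiv L u : Equiv.Perm ℍ) q = q * ↑(u : ℍˣ)⁻¹ := rfl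

theorem autTorus_ne_plusMinusOne_iff (L : AddSubgroup ℍ) :
    (autTorus L : Set (Equiv.Perm ℍ)) ≠ plusMinusOne ↔
      ∃ u ∈ unitStabilizer L, u ≠ 1 ∧ u ≠ -1 := by
  have h1 : (unitStabilizerEquiv L ⟨-1, neg_one_mem_unitStabilizer L⟩ : Equiv.Perm ℍ)
      = Equiv.neg ℍ := by
    ext q : 1
    simp [unitStabilizerEquiv_apply]
  constructor
  · intro h
    by_contra! hu
    refine h (Set.Subset.antisymm ?_ ?_)
    · intro F hF
      obtain ⟨⟨u, hu'⟩, hFu⟩ := (unitStabilizerEquiv L).surjective ⟨F, hF⟩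
      replace hFu : (unitStabilizerEquiv L ⟨u, hu'⟩ : Equiv.Perm ℍ) = F := by rw [hFu]
      rw [← hFu]
      by_cases hu1 : u = 1
      · subst hu1
        left
        ext q : 1
        simp [unitStabilizerEquiv_apply]
      · have := hu u hu' hu1
        subst this
        right
        exact h1
    · rintro F (rfl | rfl)
      · exact (autTorus L).one_mem
      · rw [← h1]
        exact SetLike.coe_mem _
  · rintro ⟨u, hu, hu1, hu2⟩ h
    have hmem : (unitStabilizerEquiv L ⟨u, hu⟩ : Equiv.Perm ℍ) ∈ plusMinusOne := by
      rw [← h]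
      exact SetLike.coe_mem _
    rcases hmem with h' | h'
    · refine hu1 (congrArg Subtype.val ((unitStabilizerEquiv L).injective
        (a₁ := ⟨u, hu⟩) (a₂ := 1) ?_))
      rw [map_one]
      exact Subtype.ext h'
    · refine hu2 (congrArg Subtype.val ((unitStabilizerEquiv L).injective
        (a₁ := ⟨u, hu⟩) (a₂ := ⟨-1, neg_one_mem_unitStabilizer L⟩) ?_))
      refine Subtype.ext ?_
      rw [h1]
      exact h'

/-- The automorphism group contains a copy of a cyclic group if and only if the stabilizer has an
element of its order. -/
theorem autContains_zpowers_iff (L : AddSubgroup ℍ) (g : ℍˣ) :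
    AutContains L (Subgroup.zpowers g) ↔ ∃ u ∈ unitStabilizer L, orderOf u = orderOf g := by
  constructor
  · rintro ⟨H, hH, ⟨e⟩⟩
    let x : H := e.symm ⟨g, Subgroup.mem_zpowers g⟩
    let u := (unitStabilizerEquiv L).symm ⟨x, hH x.2⟩
    refine ⟨u, u.2, ?_⟩
    rw [Subgroup.orderOf_coe, MulEquiv.orderOf_eq, Subgroup.orderOf_mk, Subgroup.orderOf_coe,
      MulEquiv.orderOf_eq, Subgroup.orderOf_mk]
  · rintro ⟨u, hu, h⟩
    let F : Equiv.Perm ℍ := unitStabilizerEquiv L ⟨u, hu⟩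
    refine ⟨Subgroup.zpowers F, ?_, ⟨mulEquivOfCyclicCardEq ?_⟩⟩
    · rw [Subgroup.zpowers_le]
      exact SetLike.coe_mem _
    · rw [Nat.card_zpowers, Nat.card_zpowers, ← h]
      simp only [F, Subgroup.orderOf_coe, MulEquiv.orderOf_eq, Subgroup.orderOf_mk]

/-! ### Quaternions of order 4 and 6 -/

theorem orderOf_eq_four_iff {u : ℍˣ} : orderOf u = 4 ↔ (u : ℍ) * u = -1 := by
  constructor
  · intro h
    have h4 : u ^ 4 = 1 := by rw [← h, pow_orderOf_eq_one]
    have h2 : u ^ 2 ≠ 1 := by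
      intro h2
      have := orderOf_dvd_of_pow_eq_one h2
      rw [h] at this
      norm_num at this
    have h4' : ((u : ℍ) * u - 1) * (u * u + 1) = 0 := by
      have : (u : ℍ) ^ 4 = 1 := by rw [← Units.val_pow_eq_pow_val, h4, Units.val_one]
      rw [← sub_eq_zero.2 this]
      noncomm_ring
    rcases mul_eq_zero.1 h4' with h' | h'
    · refine absurd (Units.ext ?_) h2
      rw [Units.val_pow_eq_pow_val, sq, sub_eq_zero.1 h', Units.val_one]
    · exact eq_neg_of_add_eq_zero_left h'
  · intro h
    have h2 : u ^ 2 = -1 := Units.ext (by simpa [sq] using h)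
    have hne : (-1 : ℍˣ) ≠ 1 := fun h => by
      have := congrArg (fun x : ℍˣ => (x : ℍ).re) h
      norm_num at this
    refine orderOf_eq_prime_pow (p := 2) (n := 1) ?_ ?_
    · rwa [pow_one, h2]
    · rw [pow_succ, pow_one, pow_mul, h2]
      simp

theorem orderOf_eq_six_iff {u : ℍˣ} : orderOf u = 6 ↔ (u : ℍ) * u = u - 1 := by
  constructor
  · intro h
    have h6 : u ^ 6 = 1 := by rw [← h, pow_orderOf_eq_one]
    have hne : ∀ m, m < 6 → 0 < m → u ^ m ≠ 1 := by
      intro m hm h0 h1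
      have := Nat.le_of_dvd h0 (orderOf_dvd_of_pow_eq_one h1)
      omega
    have h6' : ((u : ℍ) ^ 3 - 1) * ((u ^ 2 - 1) * (u * u - (u - 1))) = 0 := by
      have h' : (u : ℍ) ^ 6 = 1 := by rw [← Units.val_pow_eq_pow_val, h6, Units.val_one]
      have : ((u : ℍ) ^ 3 - 1) * ((u ^ 2 - 1) * (u * u - (u - 1)))
        = ((u : ℍ) ^ 6 - 1) * (u - 1) := by noncomm_ring
      rw [this, h', sub_self, zero_mul]
    rcases mul_eq_zero.1 h6' with h' | h'
    · exact absurd (Units.ext (by simpa using sub_eq_zero.1 h')) (hne 3 (by norm_num) (by norm_num))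
    rcases mul_eq_zero.1 h' with h' | h'
    · exact absurd (Units.ext (by simpa using sub_eq_zero.1 h')) (hne 2 (by norm_num) (by norm_num))
    · exact sub_eq_zero.1 h'
  · intro h
    have h3 : u ^ 3 = -1 := by
      refine Units.ext ?_
      rw [Units.val_pow_eq_pow_val, pow_succ, sq, h, sub_mul, h]
      simp
    have hne : (-1 : ℍˣ) ≠ 1 := fun h => by
      have := congrArg (fun x : ℍˣ => (x : ℍ).re) h
      norm_num at this
    refine orderOf_eq_of_pow_and_pow_div_prime (by norm_num) ?_ ?_
    · rw [show 6 = 3 * 2 from rfl, pow_mul, h3]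
      simp
    · intro p hp hp6
      have hp' : p = 2 ∨ p = 3 := by
        rw [show 6 = 2 * 3 from rfl, hp.dvd_mul, Nat.prime_dvd_prime_iff_eq hp Nat.prime_two,
          Nat.prime_dvd_prime_iff_eq hp Nat.prime_three] at hp6
        exact hp6
      rcases hp' with rfl | rfl
      · rwa [show 6 / 2 = 3 from rfl, h3]
      · rw [show 6 / 3 = 2 from rfl]
        intro h2
        have h2' : (u : ℍ) * u = 1 := by
          rw [← sq, ← Units.val_pow_eq_pow_val, h2, Units.val_one]
        have hu : (u : ℍ) = ((2 : ℝ) : ℍ) := by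
          rw [h2'] at h
          rw [eq_comm, sub_eq_iff_eq_add] at h
          rw [h, show (2 : ℝ) = 1 + 1 by norm_num, Quaternion.coe_add, Quaternion.coe_one]
        rw [hu, ← Quaternion.coe_mul] at h2'
        have := congrArg QuaternionAlgebra.re h2'
        rw [Quaternion.re_coe, Quaternion.re_one] at this
        norm_num at this

theorem sliceExp_pi_div_three (I : ℍ) :
    sliceExp (Real.pi / 3) I = ((1 / 2 : ℝ) : ℍ) + (√3 / 2) • I := by
  rw [sliceExp, Real.cos_pi_div_three, Real.sin_pi_div_three]

theorem sliceExp_pi_div_two (I : ℍ) : sliceExp (Real.pi / 2) I = I := by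
  simp [sliceExp]

theorem sliceExp_pi_div_three_mul_self {I : ℍ} (hI : I ∈ imagUnits) :
    sliceExp (Real.pi / 3) I * sliceExp (Real.pi / 3) I = sliceExp (Real.pi / 3) I - 1 := by
  have hI2 : I * I = ((-1 : ℝ) : ℍ) := by rw [← sq, show I ^ 2 = -1 from hI]; simp
  have h3 : √3 * √3 = 3 := Real.mul_self_sqrt (by norm_num)
  rw [sliceExp_pi_div_three]
  simp only [add_mul, mul_add, smul_mul_assoc, mul_smul_comm, hI2, Quaternion.coe_mul_eq_smul,
    Quaternion.mul_coe_eq_smul]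
  ext <;> simp [-Quaternion.coe_inv, -Quaternion.coe_div, -one_div] <;> linarith

theorem exists_sliceExp_eq {a : ℍ} (ha : a * a = a - 1) :
    ∃ I ∈ imagUnits, sliceExp (Real.pi / 3) I = a := by
  have h3 : √3 * √3 = 3 := Real.mul_self_sqrt (by norm_num)
  have h3' : √3 ≠ 0 := by positivity
  refine ⟨(2 / √3) • (a - ((1 / 2 : ℝ) : ℍ)), ?_, ?_⟩
  · have : (a - ((1 / 2 : ℝ) : ℍ)) * (a - ((1 / 2 : ℝ) : ℍ)) = ((-(3 / 4) : ℝ) : ℍ) := by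
      simp only [mul_sub, sub_mul, ha, Quaternion.coe_mul_eq_smul, Quaternion.mul_coe_eq_smul]
      ext <;> simp [-Quaternion.coe_inv, -Quaternion.coe_div, -one_div] <;> ring
    simp only [imagUnits, Set.mem_ofPred_eq, sq, smul_mul_smul_comm, this]
    rw [← Quaternion.coe_smul, smul_eq_mul]
    have : 2 / √3 * (2 / √3) * (-(3 / 4) : ℝ) = -1 := by
      field_simp
      nlinarith
    rw [this]
    simp
  · rw [sliceExp_pi_div_three, smul_smul, show √3 / 2 * (2 / √3) = 1 by field_simp, one_smul]
    abel

/-- The unit `e_n = e^{π i / n}`. -/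
noncomputable def expUnit (n : ℕ) : ℍˣ :=
  Units.mk0 (sliceExp (Real.pi / n) qi) (by
    intro h
    have h1 := congrArg QuaternionAlgebra.re h
    have h2 := congrArg QuaternionAlgebra.imI h
    simp [sliceExp] at h1 h2
    have := Real.sin_sq_add_cos_sq (Real.pi / n)
    simp [h1, h2] at this)

theorem twoC_eq_zpowers (n : ℕ) : twoC n = Subgroup.zpowers (expUnit n) := by
  rw [Subgroup.zpowers_eq_closure, twoC]
  congr 1
  ext u
  rw [Set.mem_singleton_iff, ← Units.val_inj]
  rfl

theorem qi_mem_imagUnits : qi ∈ imagUnits := (sq qi).trans qi_mul_qi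

theorem orderOf_expUnit_two : orderOf (expUnit 2) = 4 :=
  orderOf_eq_four_iff.2 (by
    change sliceExp (Real.pi / (2 : ℕ)) qi * sliceExp (Real.pi / (2 : ℕ)) qi = -1
    rw [Nat.cast_two, sliceExp_pi_div_two, qi_mul_qi])

theorem orderOf_expUnit_three : orderOf (expUnit 3) = 6 :=
  orderOf_eq_six_iff.2 (by exact_mod_cast sliceExp_pi_div_three_mul_self qi_mem_imagUnits)

theorem autContains_twoC_two_iff (L : AddSubgroup ℍ) :
    AutContains L (twoC 2) ↔ ∃ u ∈ unitStabilizer L, (u : ℍ) * u = -1 := by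
  rw [twoC_eq_zpowers, autContains_zpowers_iff, orderOf_expUnit_two]
  simp only [orderOf_eq_four_iff]

theorem autContains_twoC_three_iff (L : AddSubgroup ℍ) :
    AutContains L (twoC 3) ↔ ∃ u ∈ unitStabilizer L, (u : ℍ) * u = u - 1 := by
  rw [twoC_eq_zpowers, autContains_zpowers_iff, orderOf_expUnit_three]
  simp only [orderOf_eq_six_iff]

section

/-! ### Norms relative to a quadratic order -/

theorem norm_sq_eq (q : ℍ) : ‖q‖ ^ 2 = q.re ^ 2 + q.imI ^ 2 + q.imJ ^ 2 + q.imK ^ 2 := by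
  rw [sq, ← Quaternion.normSq_eq_norm_mul_self, Quaternion.normSq_def']

theorem inner_eq (p q : ℍ) :
    inner ℝ p q = p.re * q.re + p.imI * q.imI + p.imJ * q.imJ + p.imK * q.imK := by
  rw [Quaternion.inner_def]
  simp

/-- A root of `X² - t X + 1` with `t² < 4` is a unit quaternion of real part `t / 2`. -/
theorem re_eq_and_norm_eq {t : ℝ} (ht : t ^ 2 < 4) {a : ℍ} (ha : a * a = t • a - 1) :
    2 * a.re = t ∧ ‖a‖ = 1 := by
  have h0 := congrArg QuaternionAlgebra.re ha
  have h1 := congrArg QuaternionAlgebra.imI ha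
  have h2 := congrArg QuaternionAlgebra.imJ ha
  have h3 := congrArg QuaternionAlgebra.imK ha
  simp only [Quaternion.re_mul, Quaternion.imI_mul, Quaternion.imJ_mul, Quaternion.imK_mul,
    Quaternion.re_sub, Quaternion.imI_sub, Quaternion.imJ_sub, Quaternion.imK_sub,
    Quaternion.re_smul, Quaternion.imI_smul, Quaternion.imJ_smul, Quaternion.imK_smul,
    Quaternion.re_one, Quaternion.imI_one, Quaternion.imJ_one, Quaternion.imK_one,
    smul_eq_mul] at h0 h1 h2 h3
  have ht' : 2 * a.re = t := by
    by_contra hne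
    have hne' : 2 * a.re - t ≠ 0 := sub_ne_zero.2 hne
    have e1 : a.imI = 0 :=
      (mul_eq_zero.1 (by linarith : (2 * a.re - t) * a.imI = 0)).resolve_left hne'
    have e2 : a.imJ = 0 :=
      (mul_eq_zero.1 (by linarith : (2 * a.re - t) * a.imJ = 0)).resolve_left hne'
    have e3 : a.imK = 0 :=
      (mul_eq_zero.1 (by linarith : (2 * a.re - t) * a.imK = 0)).resolve_left hne'
    rw [e1, e2, e3] at h0
    nlinarith [sq_nonneg (2 * a.re - t)]
  refine ⟨ht', ?_⟩
  have : ‖a‖ ^ 2 = 1 := by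
    rw [norm_sq_eq]
    rw [← ht'] at h0
    linarith
  exact (pow_eq_one_iff_of_nonneg (norm_nonneg a) two_ne_zero).1 this

/-- The commutator `q ↦ q a - a q`. Its kernel is `ℝ + ℝ a`, and for a unit quaternion `a` of trace
`t` the norm of its value is `√(4 - t²)` times the distance to the kernel. -/
def commL (a : ℍ) : ℍ →ₗ[ℝ] ℍ := LinearMap.mulRight ℝ a - LinearMap.mulLeft ℝ a

theorem commL_apply (a q : ℍ) : commL a q = q * a - a * q := rfl

variable {t : ℝ} {a : ℍ}

theorem norm_add_smul_sq (hre : 2 * a.re = t) (hn : ‖a‖ = 1) (x y : ℝ) :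
    ‖(x : ℍ) + y • a‖ ^ 2 = x ^ 2 + t * x * y + y ^ 2 := by
  have h1 : a.re ^ 2 + a.imI ^ 2 + a.imJ ^ 2 + a.imK ^ 2 = 1 := by rw [← norm_sq_eq, hn, one_pow]
  rw [norm_sq_eq]
  simp
  rw [← hre]
  linear_combination y ^ 2 * h1

/-- Pythagoras for the orthogonal projection `x + y a` of `q` to `ℝ + ℝ a`. -/
theorem exists_norm_sq_eq (ht : t ^ 2 < 4) (hre : 2 * a.re = t) (hn : ‖a‖ = 1) (q : ℍ) :
    ∃ x y : ℝ, ∀ m n : ℝ, ‖q - (m + n • a)‖ ^ 2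
      = (x - m) ^ 2 + t * (x - m) * (y - n) + (y - n) ^ 2 + ‖commL a q‖ ^ 2 / (4 - t ^ 2) := by
  have h1 : a.re ^ 2 + a.imI ^ 2 + a.imJ ^ 2 + a.imK ^ 2 = 1 := by rw [← norm_sq_eq, hn, one_pow]
  have h4 : 4 - t ^ 2 ≠ 0 := by linarith
  have h5 : 4 - t ^ 2 = 4 * (a.imI ^ 2 + a.imJ ^ 2 + a.imK ^ 2) := by
    rw [← hre]
    linear_combination (-4) * h1
  have h6 : a.imI ^ 2 + a.imJ ^ 2 + a.imK ^ 2 ≠ 0 := by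
    intro h
    rw [h5, h] at h4
    simp at h4
  obtain ⟨y, hy⟩ : ∃ y, y * (a.imI ^ 2 + a.imJ ^ 2 + a.imK ^ 2)
    = q.imI * a.imI + q.imJ * a.imJ + q.imK * a.imK := ⟨_, div_mul_cancel₀ _ h6⟩
  refine ⟨q.re - a.re * y, y, fun m n => ?_⟩
  have hc : ‖commL a q‖ ^ 2 / (4 - t ^ 2) = q.imI ^ 2 + q.imJ ^ 2 + q.imK ^ 2
      - y ^ 2 * (a.imI ^ 2 + a.imJ ^ 2 + a.imK ^ 2) := by
    rw [div_eq_iff h4, h5, norm_sq_eq, commL_apply]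
    simp
    linear_combination 4 * (y * (a.imI ^ 2 + a.imJ ^ 2 + a.imK ^ 2)
      + (q.imI * a.imI + q.imJ * a.imJ + q.imK * a.imK)) * hy
  rw [hc, norm_sq_eq, ← hre]
  simp
  linear_combination (y - n) ^ 2 * h1 + 2 * n * hy

/-- Subtracting a suitable element of `ℤ + ℤ a` makes the component along `ℝ + ℝ a` have norm at
most `√(1/2)`. -/
theorem exists_int_norm_sq_le (ht : t ^ 2 < 4) (hre : 2 * a.re = t) (hn : ‖a‖ = 1) (q : ℍ) :
    ∃ m n : ℤ, ‖q - (((m : ℝ) : ℍ) + (n : ℝ) • a)‖ ^ 2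
      ≤ 1 / 2 + ‖commL a q‖ ^ 2 / (4 - t ^ 2) := by
  obtain ⟨x, y, h⟩ := exists_norm_sq_eq ht hre hn q
  refine ⟨round (x + t / 2 * (y - round y)), round y, ?_⟩
  rw [h]
  have h1 := abs_le.1 (abs_sub_round y)
  have h2 := abs_le.1 (abs_sub_round (x + t / 2 * (y - round y)))
  set v := y - round y
  set u := x + t / 2 * v - round (x + t / 2 * v) with hu
  have hx : x - round (x + t / 2 * v) = u - t / 2 * v := by rw [hu]; ring
  rw [hx]
  nlinarith [mul_nonneg (sub_nonneg.2 h1.2) (sub_nonneg.2 h1.1),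
    mul_nonneg (sub_nonneg.2 h2.2) (sub_nonneg.2 h2.1), mul_nonneg (sq_nonneg t) (sq_nonneg v)]

/-- The kernel of the commutator with `a` is `ℝ + ℝ a`. -/
theorem exists_eq_add_smul (ht : t ^ 2 < 4) (hre : 2 * a.re = t) (hn : ‖a‖ = 1) {q : ℍ}
    (hq : commL a q = 0) : ∃ x y : ℝ, q = x + y • a := by
  obtain ⟨x, y, h⟩ := exists_norm_sq_eq ht hre hn q
  refine ⟨x, y, ?_⟩
  have := h x y
  rw [hq] at this
  simp only [sub_self, mul_zero, norm_zero] at this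
  rw [← sub_eq_zero, ← norm_eq_zero, ← sq_eq_zero_iff, this]
  norm_num

theorem commL_mul (q : ℍ) {g : ℍ} (hg : commL a g = 0) : commL a (q * g) = commL a q * g := by
  rw [commL_apply, sub_eq_zero] at hg
  rw [commL_apply, commL_apply, sub_mul, mul_assoc, hg]
  simp only [mul_assoc]

theorem commL_self (x y : ℝ) : commL a (x + y • a) = 0 := by
  simp [commL_apply, add_mul, mul_add, Quaternion.coe_mul_eq_smul, Quaternion.mul_coe_eq_smul]

/-- The quotient of two commutators with `a` commutes with `a`. -/
theorem commL_inv_mul (ha : a * a = t • a - 1) (p q : ℍ) :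
    commL a ((commL a p)⁻¹ * commL a q) = 0 := by
  -- commutators anticommute with the imaginary part of `a`
  have key : ∀ q, commL a q * a = (t • 1 - a) * commL a q := by
    intro q
    simp only [commL_apply, sub_mul, mul_sub, mul_assoc, ha]
    simp only [← mul_assoc, ha]
    simp only [sub_mul, smul_mul_assoc, mul_smul_comm, one_mul, mul_one, mul_assoc]
    abel
  by_cases hp : commL a p = 0
  · simp [hp]
  rw [commL_apply, mul_assoc, key, ← mul_assoc, ← mul_assoc, sub_eq_zero]
  congr 1
  have h := key p
  rw [eq_comm, ← mul_right_inj' (inv_ne_zero hp), ← mul_left_inj' (inv_ne_zero hp)] at h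
  rw [mul_assoc, mul_assoc, mul_inv_cancel₀ hp, mul_one] at h
  rw [h, ← mul_assoc, inv_mul_cancel₀ hp, one_mul]

/-! ### Reduced bases of lattices with a quadratic order of multipliers -/

/-- A nonempty part of a lattice has an element of least norm. -/
theorem IsRankFourLattice.exists_norm_min {L : AddSubgroup ℍ} (hL : IsRankFourLattice L)
    {S : Set ℍ} (hS : S ⊆ L) (hne : S.Nonempty) : ∃ q ∈ S, ∀ p ∈ S, ‖q‖ ≤ ‖p‖ := by
  obtain ⟨q₀, hq₀⟩ := hne
  have hfin : {q : ℍ | q ∈ S ∧ ‖q‖ ≤ ‖q₀‖}.Finite :=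
    (hL.finite_norm_le ‖q₀‖).subset fun q hq => ⟨hS hq.1, hq.2⟩
  obtain ⟨q, hq, hmin⟩ := Set.exists_min_image _ (fun q : ℍ => ‖q‖) hfin ⟨q₀, hq₀, le_rfl⟩
  refine ⟨q, hq.1, fun p hp => ?_⟩
  rcases le_total ‖p‖ ‖q₀‖ with h | h
  · exact hmin p ⟨hp, h⟩
  · exact hq.2.trans h

theorem IsRankFourLattice.exists_commL_ne_zero {L : AddSubgroup ℍ} (hL : IsRankFourLattice L)
    (ht : t ^ 2 < 4) (haa : a * a = t • a - 1) : ∃ q ∈ L, commL a q ≠ 0 := by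
  obtain ⟨hre, hn⟩ := re_eq_and_norm_eq ht haa
  obtain ⟨v, hv, rfl⟩ := hL
  obtain ⟨b, rfl⟩ := exists_basis_coe_eq hv
  by_contra! h
  have h0 : commL a = 0 := b.ext fun i => h _ (AddSubgroup.subset_closure ⟨i, rfl⟩)
  have h1 : commL a qi = 0 := by rw [h0]; rfl
  have h2 : commL a qj = 0 := by rw [h0]; rfl
  have e1 := congrArg QuaternionAlgebra.imJ h1
  have e2 := congrArg QuaternionAlgebra.imK h1
  have e3 := congrArg QuaternionAlgebra.imK h2
  simp [commL_apply] at e1 e2 e3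
  have h3 := norm_sq_eq a
  rw [hn] at h3
  have i1 : a.imI = 0 := by linarith
  have i2 : a.imJ = 0 := by linarith
  have i3 : a.imK = 0 := by linarith
  rw [i1, i2, i3] at h3
  rw [← hre] at ht
  nlinarith

theorem linearIndependent_of_commL_ne_zero (ht : t ^ 2 < 4) (haa : a * a = t • a - 1) {α : ℍ}
    (hα : commL a α ≠ 0) : LinearIndependent ℝ ![1, a, α, α * a] := by
  obtain ⟨hre, hn⟩ := re_eq_and_norm_eq ht haa
  have hzero : ∀ x y : ℝ, (x : ℍ) + y • a = 0 → x = 0 ∧ y = 0 := by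
    intro x y h
    have h1 := norm_add_smul_sq hre hn x y
    rw [h, norm_zero] at h1
    have hy : y = 0 := by
      by_contra hy
      have : 0 < y ^ 2 := by positivity
      nlinarith [sq_nonneg (x + t / 2 * y)]
    subst hy
    refine ⟨?_, rfl⟩
    nlinarith
  rw [Fintype.linearIndependent_iff]
  intro c hc
  rw [Fin.sum_univ_four] at hc
  simp only [Matrix.cons_val, ← Quaternion.coe_mul_eq_smul (c 0), mul_one] at hc
  have hg := commL_self (a := a) (c 2) (c 3)
  have h23 : (c 2 : ℍ) + c 3 • a = 0 := by
    have h1 : ((c 0 : ℍ) + c 1 • a) + α * ((c 2 : ℍ) + c 3 • a) = 0 := by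
      rw [← hc, mul_add, Quaternion.mul_coe_eq_smul, mul_smul_comm, add_assoc, add_assoc,
        add_assoc]
    have h2 := congrArg (commL a) h1
    rw [map_add, commL_self, zero_add, commL_mul _ hg, map_zero] at h2
    exact (mul_eq_zero.1 h2).resolve_left hα
  obtain ⟨h2, h3⟩ := hzero _ _ h23
  have h01 : (c 0 : ℍ) + c 1 • a = 0 := by
    rw [← hc, h2, h3]
    simp
  obtain ⟨h0, h1⟩ := hzero _ _ h01
  intro i
  fin_cases i <;> assumption

/-- Let `1` be a shortest vector of a lattice `M` with `M a ⊆ M`, where `a` generates the Gaussian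
or the Eisenstein integers. Take `α ∈ M` whose distance to `ℝ + ℝ a` is minimal, and of least norm
among these. As both rings are Euclidean, `1, a, α, αa` generate `M`; and `α` is shortest outside
of `ℤ + ℤ a`, because a non-unit of these rings has norm at least `√2`. -/
theorem IsRankFourLattice.exists_generator {M : AddSubgroup ℍ} (hM : IsRankFourLattice M)
    (h1 : (1 : ℍ) ∈ M) (hmin : ∀ q ∈ M, q ≠ 0 → 1 ≤ ‖q‖) (hMa : ∀ q ∈ M, q * a ∈ M)
    (ht : t = 0 ∨ t = 1) (haa : a * a = t • a - 1) :
    ∃ α ∈ M, commL a α ≠ 0 ∧ 0 ≤ inner ℝ a α ∧ M = latticeOf ![1, a, α, α * a] ∧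
      ∀ q ∈ M, commL a q ≠ 0 → ‖α‖ ≤ ‖q‖ := by
  have ht4 : t ^ 2 < 4 := by rcases ht with rfl | rfl <;> norm_num
  have ht4' : 0 < 4 - t ^ 2 := by linarith
  obtain ⟨hre, hn⟩ := re_eq_and_norm_eq ht4 haa
  have hmul : ∀ q ∈ M, ∀ m n : ℤ, q * (((m : ℝ) : ℍ) + (n : ℝ) • a) ∈ M := by
    intro q hq m n
    rw [mul_add, Quaternion.mul_coe_eq_smul, mul_smul_comm, Int.cast_smul_eq_zsmul,
      Int.cast_smul_eq_zsmul]
    exact M.add_mem (M.zsmul_mem hq m) (M.zsmul_mem (hMa q hq) n)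
  have hcomb : ∀ m n : ℤ, ((m : ℝ) : ℍ) + (n : ℝ) • a ∈ M := fun m n => by
    simpa using hmul 1 h1 m n
  -- the lattice vectors of `ℝ + ℝ a` are the elements of `ℤ + ℤ a`
  have hker : ∀ q ∈ M, commL a q = 0 → ∃ m n : ℤ, q = ((m : ℝ) : ℍ) + (n : ℝ) • a := by
    intro q hq hq0
    obtain ⟨m, n, h⟩ := exists_int_norm_sq_le ht4 hre hn q
    refine ⟨m, n, ?_⟩
    by_contra hne
    have := hmin _ (M.sub_mem hq (hcomb m n)) (sub_ne_zero.2 hne)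
    rw [hq0] at h
    simp only [norm_zero] at h
    norm_num at h
    nlinarith
  -- the distance to `ℝ + ℝ a` has a least nonzero value on `M`
  obtain ⟨w, hwM, hw0, hw⟩ : ∃ w ∈ M, commL a w ≠ 0 ∧
      ∀ q ∈ M, commL a q ≠ 0 → ‖commL a w‖ ≤ ‖commL a q‖ := by
    obtain ⟨q₀, hq₀, hq₀'⟩ := hM.exists_commL_ne_zero ht4 haa
    let R := √(1 / 2 + ‖commL a q₀‖ ^ 2 / (4 - t ^ 2))
    have hred : ∀ q ∈ M, commL a q ≠ 0 → ‖commL a q‖ ≤ ‖commL a q₀‖ →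
        ∃ p ∈ M, commL a p = commL a q ∧ ‖p‖ ≤ R := by
      intro q hq _ hle
      obtain ⟨m, n, h⟩ := exists_int_norm_sq_le ht4 hre hn q
      refine ⟨_, M.sub_mem hq (hcomb m n), by rw [map_sub, commL_self, sub_zero], ?_⟩
      refine Real.le_sqrt_of_sq_le (h.trans ?_)
      gcongr
    have hfin : {q : ℍ | q ∈ M ∧ ‖q‖ ≤ R ∧ commL a q ≠ 0}.Finite :=
      (hM.finite_norm_le R).subset fun q hq => ⟨hq.1, hq.2.1⟩
    obtain ⟨p₀, hp₀, hpq, hpR⟩ := hred q₀ hq₀ hq₀' le_rfl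
    obtain ⟨w, ⟨hw1, hw2, hw3⟩, hwmin⟩ := Set.exists_min_image _ (fun q : ℍ => ‖commL a q‖) hfin
      ⟨p₀, hp₀, hpR, by rwa [hpq]⟩
    refine ⟨w, hw1, hw3, fun q hq hq0 => ?_⟩
    rcases le_total ‖commL a q‖ ‖commL a q₀‖ with h | h
    · obtain ⟨p, hp, hpq', hpR'⟩ := hred q hq hq0 h
      rw [← hpq']
      exact hwmin p ⟨hp, hpR', by rwa [hpq']⟩
    · refine le_trans ?_ h
      rw [← hpq]
      exact hwmin p₀ ⟨hp₀, hpR, by rwa [hpq]⟩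
  obtain ⟨α₀, ⟨hα₀M, hα₀w⟩, hα₀min⟩ := hM.exists_norm_min
    (S := {q | q ∈ M ∧ ‖commL a q‖ = ‖commL a w‖}) (fun q hq => hq.1) ⟨w, hwM, rfl⟩
  -- a change of sign makes the product with `a` nonnegative
  obtain ⟨α, hαM, hαw, hαmin, hαa⟩ : ∃ α ∈ M, ‖commL a α‖ = ‖commL a w‖ ∧
      (∀ q ∈ M, ‖commL a q‖ = ‖commL a w‖ → ‖α‖ ≤ ‖q‖) ∧ 0 ≤ inner ℝ a α := by
    rcases le_total 0 (inner ℝ a α₀) with h | h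
    · exact ⟨α₀, hα₀M, hα₀w, fun q hq hq' => hα₀min q ⟨hq, hq'⟩, h⟩
    · exact ⟨-α₀, M.neg_mem hα₀M, by rw [map_neg, norm_neg, hα₀w],
        fun q hq hq' => by rw [norm_neg]; exact hα₀min q ⟨hq, hq'⟩, by rw [inner_neg_right]; linarith⟩
  have hα0 : commL a α ≠ 0 := by rw [← norm_ne_zero_iff, hαw, norm_ne_zero_iff]; exact hw0
  rw [← hαw] at hαmin hw
  have hgen : ∀ q ∈ M, ∃ m n k l : ℤ, q = (((m : ℝ) : ℍ) + (n : ℝ) • a)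
      + α * (((k : ℝ) : ℍ) + (l : ℝ) • a) := by
    intro q hq
    have hz := commL_inv_mul haa α q
    obtain ⟨k, l, hkl⟩ := exists_int_norm_sq_le ht4 hre hn ((commL a α)⁻¹ * commL a q)
    have hq' := M.sub_mem hq (hmul α hαM k l)
    obtain ⟨m, n, hmn⟩ := hker _ hq' (by
      by_contra hne
      have h2 := hw _ hq' hne
      rw [map_sub, commL_mul _ (commL_self _ _)] at h2
      have h3 : commL a q - commL a α * (((k : ℝ) : ℍ) + (l : ℝ) • a)
          = commL a α * ((commL a α)⁻¹ * commL a q - (((k : ℝ) : ℍ) + (l : ℝ) • a)) := by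
        rw [mul_sub, mul_inv_cancel_left₀ hα0]
      rw [h3, norm_mul] at h2
      have h4 := le_of_mul_le_mul_left ((mul_one _).trans_le h2) (norm_pos_iff.2 hα0)
      rw [hz] at hkl
      simp only [norm_zero] at hkl
      norm_num at hkl
      nlinarith)
    exact ⟨m, n, k, l, by rw [← hmn, sub_add_cancel]⟩
  have hlat : M = latticeOf ![1, a, α, α * a] := by
    ext q
    rw [mem_latticeOf]
    simp only [Fin.sum_univ_four, Matrix.cons_val]
    have hform : ∀ m n k l : ℤ, (((m : ℝ) : ℍ) + (n : ℝ) • a) + α * (((k : ℝ) : ℍ) + (l : ℝ) • a)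
        = (m : ℝ) • (1 : ℍ) + (n : ℝ) • a + (k : ℝ) • α + (l : ℝ) • (α * a) := by
      intro m n k l
      rw [mul_add, Quaternion.mul_coe_eq_smul, mul_smul_comm, ← Quaternion.coe_mul_eq_smul (m : ℝ) 1,
        mul_one, add_assoc, add_assoc, add_assoc]
    constructor
    · intro hq
      obtain ⟨m, n, k, l, h⟩ := hgen q hq
      exact ⟨![m, n, k, l], by rw [h, hform]; simp⟩
    · rintro ⟨c, rfl⟩
      rw [← hform]
      exact M.add_mem (hcomb _ _) (hmul _ hαM _ _)
  have hαn : ‖α‖ ^ 2 ≤ 1 / 2 + ‖commL a α‖ ^ 2 / (4 - t ^ 2) := by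
    obtain ⟨m, n, h⟩ := exists_int_norm_sq_le ht4 hre hn α
    refine le_trans ?_ h
    have := hαmin _ (M.sub_mem hαM (hcomb m n)) (by rw [map_sub, commL_self, sub_zero])
    gcongr
  have hα1 : 1 ≤ ‖α‖ := hmin α hαM (by rintro rfl; simp at hα0)
  refine ⟨α, hαM, hα0, hαa, hlat, fun q hq hq0 => ?_⟩
  obtain ⟨m, n, k, l, hqe⟩ := hgen q hq
  have hcq : commL a q = commL a α * (((k : ℝ) : ℍ) + (l : ℝ) • a) := by
    rw [hqe, map_add, commL_self, zero_add, commL_mul _ (commL_self _ _)]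
  have hnorm := norm_add_smul_sq hre hn k l
  obtain ⟨N, hN⟩ : ∃ N : ℤ, ‖((k : ℝ) : ℍ) + (l : ℝ) • a‖ ^ 2 = N := by
    rw [hnorm]
    rcases ht with rfl | rfl
    · exact ⟨k ^ 2 + l ^ 2, by push_cast; ring⟩
    · exact ⟨k ^ 2 + k * l + l ^ 2, by push_cast; ring⟩
  have hN0 : 0 < N := by
    have : (0 : ℝ) < N := by
      rw [← hN]
      refine pow_pos (norm_pos_iff.2 ?_) 2
      intro h
      rw [hcq, h, mul_zero] at hq0
      exact hq0 rfl
    exact_mod_cast this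
  rcases (show 1 ≤ N from hN0).eq_or_lt with h | h
  · -- `k + l a` is a unit, so that `q` is as far from `ℝ + ℝ a` as `α`
    refine hαmin q hq ?_
    rw [← h, Int.cast_one] at hN
    rw [hcq, norm_mul, (pow_eq_one_iff_of_nonneg (norm_nonneg _) two_ne_zero).1 hN, mul_one]
  · -- `q` is at least `√2` times as far from `ℝ + ℝ a` as `α`, which outweighs the component of
    -- `α` along `ℝ + ℝ a`
    have h2 : (2 : ℝ) ≤ N := by exact_mod_cast h
    have h3 : 2 * (‖commL a α‖ ^ 2 / (4 - t ^ 2)) ≤ ‖q‖ ^ 2 := by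
      obtain ⟨x, y, hxy⟩ := exists_norm_sq_eq ht4 hre hn q
      have := hxy 0 0
      rw [hcq, norm_mul, mul_pow, hN] at this
      simp only [Quaternion.coe_zero, zero_smul, add_zero, sub_zero] at this
      rw [this]
      have h5 : ‖commL a α‖ ^ 2 * N / (4 - t ^ 2) = N * (‖commL a α‖ ^ 2 / (4 - t ^ 2)) := by ring
      have h6 : 0 ≤ ‖commL a α‖ ^ 2 / (4 - t ^ 2) := by positivity
      have h7 := norm_add_smul_sq hre hn x y
      rw [h5, ← h7]
      nlinarith [sq_nonneg ‖(x : ℍ) + y • a‖]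
    refine (sq_le_sq₀ (norm_nonneg _) (norm_nonneg _)).1 ?_
    nlinarith

/-! ### Reduced Gram matrices -/

theorem intForm_gramMatrix (v : Fin 4 → ℍ) (u w : Fin 4 → ℤ) :
    intForm (gramMatrix v) u w = inner ℝ (∑ k, (u k : ℝ) • v k) (∑ k, (w k : ℝ) • v k) := by
  simp only [intForm, gramMatrix, Matrix.of_apply, sum_inner, inner_sum, real_inner_smul_left,
    real_inner_smul_right]
  rw [Finset.sum_comm]
  refine Finset.sum_congr rfl fun k _ => Finset.sum_congr rfl fun l _ => ?_
  ring

theorem det_eq_of_first_rows {V : Matrix (Fin 4) (Fin 4) ℤ}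
    (h0 : V 0 = (1 : Matrix (Fin 4) (Fin 4) ℤ) 0) (h1 : V 1 = (1 : Matrix (Fin 4) (Fin 4) ℤ) 1) :
    V.det = V 2 2 * V 3 3 - V 2 3 * V 3 2 := by
  rw [Matrix.det_succ_row_zero]
  simp only [h0, Fin.sum_univ_four]
  simp [Matrix.det_fin_three, Fin.succAbove, h1, Fin.ext_iff]

/-- A basis of a lattice is reduced as soon as its first two vectors are shortest, and its last two
are shortest among the lattice vectors outside of the plane of the first two. -/
theorem isReducedGram_of_norm_le {v : Fin 4 → ℍ} (hv : LinearIndependent ℝ v)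
    (h0 : ∀ q ∈ latticeOf v, q ≠ 0 → ‖v 0‖ ≤ ‖q‖) (h1 : ‖v 1‖ ≤ ‖v 0‖)
    (h2 : ∀ c : Fin 4 → ℤ, c 2 ≠ 0 ∨ c 3 ≠ 0 → ‖v 2‖ ≤ ‖∑ k, (c k : ℝ) • v k‖)
    (h3 : ‖v 3‖ ≤ ‖v 2‖) (h01 : 0 ≤ inner ℝ (v 0) (v 1)) (h12 : 0 ≤ inner ℝ (v 1) (v 2))
    (h23 : 0 ≤ inner ℝ (v 2) (v 3)) : IsReducedGram (gramMatrix v) := by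
  have hone : ∀ k, ∑ l, (((1 : Matrix (Fin 4) (Fin 4) ℤ) k l : ℤ) : ℝ) • v l = v k := by
    intro k
    simp [Matrix.one_apply, ite_smul]
  have hself : ∀ u : Fin 4 → ℤ, intForm (gramMatrix v) u u = ‖∑ k, (u k : ℝ) • v k‖ ^ 2 := by
    intro u
    rw [intForm_gramMatrix, real_inner_self_eq_norm_sq]
  have hshort : ∀ u : Fin 4 → ℤ, u ≠ 0 → ‖v 0‖ ≤ ‖∑ k, (u k : ℝ) • v k‖ := by
    intro u hu
    refine h0 _ (mem_latticeOf.2 ⟨u, rfl⟩) fun h => hu ?_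
    funext k
    exact_mod_cast Fintype.linearIndependent_iff.1 hv _ h k
  have hrow : ∀ V : Matrix (Fin 4) (Fin 4) ℤ, IsUnit V.det → ∀ k, V k ≠ 0 := by
    intro V hV k hk
    rw [Matrix.det_eq_zero_of_row_eq_zero k (fun l => congrFun hk l)] at hV
    exact not_isUnit_zero hV
  refine ⟨v, hv, 1, ⟨by simp, ?_, ?_, ?_⟩, by simp⟩
  · intro u hu
    rw [hself, hself, hone]
    gcongr
    exact hshort u hu
  · intro k hk V hV hVl
    rw [hself, hself, hone]
    gcongr
    fin_cases k
    · exact absurd rfl hk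
    · exact h1.trans (hshort _ (hrow V hV 1))
    · refine h2 _ ?_
      by_contra! h
      obtain ⟨h22, h23⟩ : V 2 2 = 0 ∧ V 2 3 = 0 := h
      rw [det_eq_of_first_rows (hVl 0 (by decide)) (hVl 1 (by decide)), h22, h23] at hV
      simp at hV
    · refine h3.trans (h2 _ (Or.inr ?_))
      intro h33
      replace h33 : V 3 3 = 0 := h33
      have hV23 : V 2 3 = 0 := by rw [hVl 2 (by decide)]; rfl
      rw [det_eq_of_first_rows (hVl 0 (by decide)) (hVl 1 (by decide)), h33, hV23] at hV
      simp at hV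
  · intro k
    rw [intForm_gramMatrix, hone, hone]
    fin_cases k <;> assumption

/-! ### Automorphisms and moduli -/

/-- A torus with a multiplier `u` that generates the Gaussian or the Eisenstein integers has a
modulus `(a, α, α a)` with `a` conjugate to `u`. -/
theorem exists_isModulus {L : AddSubgroup ℍ} (hL : IsRankFourLattice L)
    (ht : t = 0 ∨ t = 1) {u : ℍ} (hu : u * u = t • u - 1) (hLu : ∀ q ∈ L, q * u ∈ L) :
    ∃ a α : ℍ, a * a = t • a - 1 ∧ 1 ≤ ‖α‖ ∧ IsModulus L (a, α, α * a) := by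
  have ht4 : t ^ 2 < 4 := by rcases ht with rfl | rfl <;> norm_num
  obtain ⟨v₁, ⟨hv₁, hv₁0⟩, hv₁min⟩ := hL.exists_norm_min (S := {q | q ∈ L ∧ q ≠ 0})
    (fun q hq => hq.1) hL.exists_ne_zero
  have hi0 : v₁⁻¹ ≠ 0 := inv_ne_zero hv₁0
  have hM := hL.mulRightLattice hi0
  have hmem : ∀ {q}, q ∈ mulRightLattice L v₁⁻¹ ↔ q * v₁ ∈ L := by
    intro q
    rw [mem_mulRightLattice hi0, inv_inv]
  let a := v₁ * u * v₁⁻¹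
  have haa : a * a = t • a - 1 := by
    calc a * a = v₁ * (u * u) * v₁⁻¹ := by simp only [a, mul_assoc, inv_mul_cancel_left₀ hv₁0]
      _ = t • a - 1 := by
        rw [hu, mul_sub, sub_mul, mul_one, mul_inv_cancel₀ hv₁0, mul_smul_comm, smul_mul_assoc]
  obtain ⟨hre, hn⟩ := re_eq_and_norm_eq ht4 haa
  have h1M : (1 : ℍ) ∈ mulRightLattice L v₁⁻¹ := hmem.2 (by rwa [one_mul])
  have hMmin : ∀ q ∈ mulRightLattice L v₁⁻¹, q ≠ 0 → 1 ≤ ‖q‖ := by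
    intro q hq hq0
    have := hv₁min (q * v₁) ⟨hmem.1 hq, mul_ne_zero hq0 hv₁0⟩
    rw [norm_mul] at this
    exact le_of_mul_le_mul_right ((one_mul _).trans_le this) (norm_pos_iff.2 hv₁0)
  have hMa : ∀ q ∈ mulRightLattice L v₁⁻¹, q * a ∈ mulRightLattice L v₁⁻¹ := by
    intro q hq
    rw [hmem]
    have : q * a * v₁ = q * v₁ * u := by simp only [a, mul_assoc, inv_mul_cancel₀ hv₁0, mul_one]
    rw [this]
    exact hLu _ (hmem.1 hq)
  obtain ⟨α, hαM, hα0, hαa, hlat, hαmin⟩ := hM.exists_generator h1M hMmin hMa ht haa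
  have hli := linearIndependent_of_commL_ne_zero ht4 haa hα0
  refine ⟨a, α, haa, hMmin α hαM (by rintro rfl; simp at hα0), ⟨hli, ?_, rfl⟩, ?_⟩
  · have hta : inner ℝ (1 : ℍ) a = t / 2 := by
      rw [inner_eq]
      simp
      linarith
    refine isReducedGram_of_norm_le hli ?_ ?_ ?_ ?_ ?_ ?_ ?_
    · intro q hq hq0
      rw [← hlat] at hq
      simpa using hMmin q hq hq0
    · simp [hn]
    · intro c hc
      refine hαmin _ (hlat ▸ mem_latticeOf.2 ⟨c, rfl⟩) fun h => ?_
      obtain ⟨x, y, hxy⟩ := exists_eq_add_smul ht4 hre hn h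
      have h0 : ∑ k, ((c k : ℝ) - ![x, y, 0, 0] k) • (![1, a, α, α * a] : Fin 4 → ℍ) k = 0 := by
        simp only [sub_smul, Finset.sum_sub_distrib]
        refine sub_eq_zero.2 (Eq.trans hxy ?_)
        simp [Fin.sum_univ_four, ← Quaternion.coe_mul_eq_smul x]
      have h2 := Fintype.linearIndependent_iff.1 hli _ h0 2
      have h3 := Fintype.linearIndependent_iff.1 hli _ h0 3
      simp at h2 h3
      rcases hc with h | h
      · exact h h2
      · exact h h3
    · simp [hn]
    · change 0 ≤ inner ℝ (1 : ℍ) a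
      rw [hta]
      rcases ht with rfl | rfl <;> norm_num
    · exact hαa
    · change 0 ≤ inner ℝ α (α * a)
      have : inner ℝ α (α * a) = ‖α‖ ^ 2 * (t / 2) := by
        rw [inner_eq, norm_sq_eq, ← hre]
        simp
        ring
      rw [this]
      rcases ht with rfl | rfl
      · simp
      · positivity
  · exact hlat ▸ equivalentTori_mulRightLattice hL hi0

/-- A modulus `(a, α, α a)` yields a multiplier conjugate to `a`. -/
theorem exists_mem_unitStabilizer {L : AddSubgroup ℍ} (hL : IsRankFourLattice L) (ht : t ^ 2 < 4)
    {a α : ℍ} (haa : a * a = t • a - 1) (hmod : IsModulus L (a, α, α * a))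
    (hint : ∃ n : ℤ, t = n) : ∃ u ∈ unitStabilizer L, (u : ℍ) * u = t • (u : ℍ) - 1 := by
  obtain ⟨hre, hn⟩ := re_eq_and_norm_eq ht haa
  obtain ⟨n, rfl⟩ := hint
  have ha0 : a ≠ 0 := by
    rintro rfl
    simp at hn
  obtain ⟨⟨hli, -, -⟩, heq⟩ := hmod
  simp only at hli heq
  set L' := latticeOf ![1, a, α, α * a] with hL'
  obtain ⟨c, hc0, hc⟩ := heq.exists_eq_mulRightLattice hL ⟨_, hli, rfl⟩
  have hmem : ∀ k, (![1, a, α, α * a] : Fin 4 → ℍ) k ∈ L' := fun k =>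
    AddSubgroup.subset_closure ⟨k, rfl⟩
  have hinv : ∀ q ∈ L', q * a ∈ L' := by
    intro q hq
    induction hq using AddSubgroup.closure_induction with
    | mem x hx =>
      have hsq : ∀ x ∈ L', x * a ∈ L' → x * a * a ∈ L' := by
        intro x hx hxa
        rw [mul_assoc, haa, mul_sub, mul_smul_comm, mul_one, Int.cast_smul_eq_zsmul]
        exact L'.sub_mem (L'.zsmul_mem hxa n) hx
      obtain ⟨k, rfl⟩ := hx
      fin_cases k
      · simpa using hmem 1
      · simpa using hsq 1 (hmem 0) (by simpa using hmem 1)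
      · exact hmem 3
      · exact hsq α (hmem 2) (hmem 3)
    | zero => simp [L'.zero_mem]
    | add x y _ _ hx hy => rw [add_mul]; exact L'.add_mem hx hy
    | neg x _ hx => rw [neg_mul]; exact L'.neg_mem hx
  have hinv' : ∀ q, q * a ∈ L' ↔ q ∈ L' := by
    refine fun q => ⟨fun h => ?_, hinv q⟩
    -- `q = t (q a) - (q a) a`
    have h2 : q = (n : ℝ) • (q * a) - q * a * a := by
      rw [mul_assoc, haa, mul_sub, mul_smul_comm, mul_one]
      abel
    rw [h2, Int.cast_smul_eq_zsmul]
    exact L'.sub_mem (L'.zsmul_mem h n) (hinv _ h)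
  have hLc : ∀ q, q ∈ L ↔ q * c ∈ L' := by
    intro q
    rw [hL', hc, mem_mulRightLattice hc0, mul_inv_cancel_right₀ hc0]
  have hu0 : c * a * c⁻¹ ≠ 0 := mul_ne_zero (mul_ne_zero hc0 ha0) (inv_ne_zero hc0)
  refine ⟨Units.mk0 _ hu0, ⟨?_, fun q => ?_⟩, ?_⟩
  · rw [Units.val_mk0, norm_mul, norm_mul, hn, norm_inv, mul_one,
      mul_inv_cancel₀ (norm_ne_zero_iff.2 hc0)]
  · rw [Units.val_mk0, hLc, hLc, ← hinv' (q * c)]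
    simp only [mul_assoc, inv_mul_cancel₀ hc0, mul_one]
  · rw [Units.val_mk0]
    calc c * a * c⁻¹ * (c * a * c⁻¹) = c * (a * a) * c⁻¹ := by
          simp only [mul_assoc, inv_mul_cancel_left₀ hc0]
      _ = _ := by
        rw [haa, mul_sub, sub_mul, mul_one, mul_inv_cancel₀ hc0, mul_smul_comm, smul_mul_assoc]

theorem hasHarmonicModulus_iff {L : AddSubgroup ℍ} (hL : IsRankFourLattice L) :
    HasHarmonicModulus L ↔ ∃ u ∈ unitStabilizer L, (u : ℍ) * u = -1 := by
  constructor
  · rintro ⟨I, hI, α, -, hmod⟩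
    have hI2 : I * I = (0 : ℝ) • I - 1 := by
      rw [← sq, show I ^ 2 = -1 from hI]
      simp
    obtain ⟨u, hu, huu⟩ := exists_mem_unitStabilizer hL (by norm_num) hI2 hmod ⟨0, by simp⟩
    exact ⟨u, hu, by simpa using huu⟩
  · rintro ⟨u, hu, huu⟩
    obtain ⟨a, α, haa, hα, hmod⟩ := exists_isModulus (t := 0) hL (Or.inl rfl) (u := u)
      (by simpa using huu) fun q hq => (hu.2 q).2 hq
    exact ⟨a, by simpa [imagUnits, sq] using haa, α, hα, hmod⟩

theorem hasEquianharmonicModulus_iff {L : AddSubgroup ℍ} (hL : IsRankFourLattice L) :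
    HasEquianharmonicModulus L ↔ ∃ u ∈ unitStabilizer L, (u : ℍ) * u = u - 1 := by
  constructor
  · rintro ⟨I, hI, α, -, hmod⟩
    obtain ⟨u, hu, huu⟩ := exists_mem_unitStabilizer (t := 1) hL (by norm_num)
      (by simpa using sliceExp_pi_div_three_mul_self hI) hmod ⟨1, by simp⟩
    exact ⟨u, hu, by simpa using huu⟩
  · rintro ⟨u, hu, huu⟩
    obtain ⟨a, α, haa, hα, hmod⟩ := exists_isModulus (t := 1) hL (Or.inr rfl) (u := u)
      (by simpa using huu) fun q hq => (hu.2 q).2 hq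
    obtain ⟨I, hI, rfl⟩ := exists_sliceExp_eq (by simpa using haa)
    exact ⟨I, hI, α, hα, hmod⟩

end

/-! ### Groups of unit quaternions with half-integral real parts -/

/-- A group of unit quaternions that contains `-1` and whose elements have half-integral real part.
The name refers to the crystallographic restriction: the elements have order 1, 2, 3, 4 or 6. -/
structure IsCrystallographic (G : Subgroup ℍˣ) : Prop where
  norm_eq_one : ∀ u ∈ G, ‖(u : ℍ)‖ = 1
  exists_two_mul_re : ∀ u ∈ G, ∃ n : ℤ, 2 * (u : ℍ).re = n
  neg_one_mem : -1 ∈ G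

theorem inv_eq_star_of_norm {u : ℍˣ} (hu : ‖(u : ℍ)‖ = 1) : ((u⁻¹ : ℍˣ) : ℍ) = star (u : ℍ) := by
  rw [Units.val_inv_eq_inv_val, Quaternion.inv_def, Quaternion.normSq_eq_norm_mul_self, hu]
  simp

theorem add_inv_eq {u : ℍˣ} (hu : ‖(u : ℍ)‖ = 1) :
    (u : ℍ) + ((u⁻¹ : ℍˣ) : ℍ) = ((2 * (u : ℍ).re : ℝ) : ℍ) := by
  rw [inv_eq_star_of_norm hu]
  ext <;> simp [-Quaternion.coe_mul, two_mul]

/-- As `q u + q u⁻¹ = (2 Re u) q`, the trace of a multiplier is an integer. -/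
theorem isCrystallographic_unitStabilizer {L : AddSubgroup ℍ} (hL : IsRankFourLattice L) :
    IsCrystallographic (unitStabilizer L) where
  norm_eq_one u hu := hu.1
  exists_two_mul_re u hu := by
    refine hL.exists_int_eq fun q hq => ?_
    have h : (2 * (u : ℍ).re) • q = q * u + q * ↑u⁻¹ := by
      rw [← mul_add, add_inv_eq hu.1, Quaternion.mul_coe_eq_smul]
    rw [h]
    exact L.add_mem ((hu.2 q).2 hq) ((((unitStabilizer L).inv_mem hu).2 q).2 hq)
  neg_one_mem := neg_one_mem_unitStabilizer L

theorem re_mul_comm (p q : ℍ) : (p * q).re = (q * p).re := by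
  simp
  ring

theorem eq_one_of_re_eq_one {q : ℍ} (hq : ‖q‖ = 1) (h : q.re = 1) : q = 1 := by
  have h1 := norm_sq_eq q
  rw [hq, h] at h1
  have h2 : q.imI = 0 := by nlinarith [sq_nonneg q.imI, sq_nonneg q.imJ, sq_nonneg q.imK]
  have h3 : q.imJ = 0 := by nlinarith [sq_nonneg q.imI, sq_nonneg q.imJ, sq_nonneg q.imK]
  have h4 : q.imK = 0 := by nlinarith [sq_nonneg q.imI, sq_nonneg q.imJ, sq_nonneg q.imK]
  ext <;> simpa

theorem mul_self_eq_of_norm {q : ℍ} (hq : ‖q‖ = 1) : q * q = (2 * q.re) • q - 1 := by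
  have h1 := norm_sq_eq q
  rw [hq] at h1
  ext <;> simp <;> linarith

namespace IsCrystallographic

variable {G : Subgroup ℍˣ} (hG : IsCrystallographic G)
include hG

theorem neg_mem {u : ℍˣ} (hu : u ∈ G) : -u ∈ G := by
  rw [← neg_one_mul]
  exact G.mul_mem hG.neg_one_mem hu

theorem eq_one {u : ℍˣ} (hu : u ∈ G) (h : (u : ℍ).re = 1) : u = 1 :=
  Units.ext (eq_one_of_re_eq_one (hG.norm_eq_one u hu) h)

theorem eq_neg_one {u : ℍˣ} (hu : u ∈ G) (h : (u : ℍ).re = -1) : u = -1 := by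
  rw [← hG.eq_one (hG.neg_mem hu) (by simp [h]), neg_neg]

theorem re_cases {u : ℍˣ} (hu : u ∈ G) : (u : ℍ).re = 0 ∨ (u : ℍ).re = 1 / 2 ∨
    (u : ℍ).re = -(1 / 2) ∨ u = 1 ∨ u = -1 := by
  obtain ⟨n, hn⟩ := hG.exists_two_mul_re u hu
  have h1 := norm_sq_eq (u : ℍ)
  rw [hG.norm_eq_one u hu] at h1
  have h2 : (n : ℝ) ^ 2 ≤ 4 := by
    rw [← hn]
    nlinarith [sq_nonneg (u : ℍ).imI, sq_nonneg (u : ℍ).imJ, sq_nonneg (u : ℍ).imK]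
  have h3 : n ^ 2 ≤ 4 := by exact_mod_cast h2
  have h4 : n ≤ 2 := by nlinarith
  have h5 : -2 ≤ n := by nlinarith
  interval_cases n
  · exact Or.inr (Or.inr (Or.inr (Or.inr (hG.eq_neg_one hu (by push_cast at hn; linarith)))))
  · exact Or.inr (Or.inr (Or.inl (by push_cast at hn; linarith)))
  · exact Or.inl (by push_cast at hn; linarith)
  · exact Or.inr (Or.inl (by push_cast at hn; linarith))
  · exact Or.inr (Or.inr (Or.inr (Or.inl (hG.eq_one hu (by push_cast at hn; linarith)))))

theorem inv_re {u : ℍˣ} (hu : u ∈ G) : ((u⁻¹ : ℍˣ) : ℍ).re = (u : ℍ).re := by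
  rw [inv_eq_star_of_norm (hG.norm_eq_one u hu), Quaternion.re_star]

/-- If no two pure elements are orthogonal, then an element of order 6 has its axis orthogonal to
every pure element `p`: otherwise `p` and its image under the rotation by 120° would be
orthogonal. -/
theorem re_mul_eq_zero (hno : ∀ p ∈ G, ∀ w ∈ G, (p : ℍ).re = 0 → (w : ℍ).re = 0 →
    ((p : ℍ) * w).re ≠ 0) {a p : ℍˣ} (ha : a ∈ G) (hp : p ∈ G) (har : (a : ℍ).re = 1 / 2)
    (hpr : (p : ℍ).re = 0) : ((a : ℍ) * p).re = 0 := by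
  have hap := G.mul_mem ha hp
  have hsq : ((a : ℍ) * p).re ^ 2 = 1 / 4 → False := by
    intro h
    refine hno p hp (a * p * a⁻¹) (G.mul_mem hap (G.inv_mem ha)) hpr ?_ ?_
    · rw [Units.val_mul, re_mul_comm, Units.val_mul, Units.inv_mul_cancel_left, hpr]
    · have hinv : ((a⁻¹ : ℍˣ) : ℍ) = 1 - a := by
        rw [eq_sub_iff_add_eq', add_inv_eq (hG.norm_eq_one a ha), har]
        norm_num
      have h1 : ((p : ℍ) * ((a * p * a⁻¹ : ℍˣ) : ℍ)).re
          = ((p : ℍ) * (p * a)).re - ((a : ℍ) * p * (a * p)).re := by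
        rw [Units.val_mul, Units.val_mul, hinv, mul_sub, mul_sub, Quaternion.re_sub, mul_one,
          re_mul_comm _ (a * p), mul_assoc (a : ℍ) p p, re_mul_comm (a : ℍ) (p * p), mul_assoc,
          ← mul_assoc (p : ℍ) (a * p) a, re_mul_comm (p * (a * p) : ℍ) a]
        simp only [mul_assoc]
      have h2 : (p : ℍ) * p = -1 := by
        rw [mul_self_eq_of_norm (hG.norm_eq_one p hp), hpr]
        simp
      have h3 := mul_self_eq_of_norm (hG.norm_eq_one _ hap)
      rw [Units.val_mul] at h3
      rw [h1, ← mul_assoc, h2, h3]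
      simp only [Quaternion.re_sub, Quaternion.re_smul, neg_mul, one_mul, Quaternion.re_neg,
        Quaternion.re_one, smul_eq_mul]
      linarith
  rcases hG.re_cases hap with h | h | h | h | h
  · rwa [Units.val_mul] at h
  · rw [Units.val_mul] at h
    exact (hsq (by rw [h]; norm_num)).elim
  · rw [Units.val_mul] at h
    exact (hsq (by rw [h]; norm_num)).elim
  · have h1 := hG.inv_re ha
    rw [inv_eq_of_mul_eq_one_right h] at h1
    linarith
  · have h1 := hG.inv_re ha
    rw [← neg_eq_iff_eq_neg, ← mul_neg] at h
    rw [inv_eq_of_mul_eq_one_right h, Units.val_neg, Quaternion.re_neg] at h1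
    linarith

/-- If no two pure elements are orthogonal, there is only one cyclic subgroup of order 6. -/
theorem eq_or_eq_inv (hno : ∀ p ∈ G, ∀ w ∈ G, (p : ℍ).re = 0 → (w : ℍ).re = 0 →
    ((p : ℍ) * w).re ≠ 0) {a b : ℍˣ} (ha : a ∈ G) (hb : b ∈ G) (har : (a : ℍ).re = 1 / 2)
    (hbr : (b : ℍ).re = 1 / 2) : b = a ∨ b = a⁻¹ := by
  have hai := G.inv_mem ha
  have hair : ((a⁻¹ : ℍˣ) : ℍ).re = 1 / 2 := by rw [hG.inv_re ha, har]
  have hsum : ((a * b : ℍˣ) : ℍ).re + ((a⁻¹ * b : ℍˣ) : ℍ).re = 1 / 2 := by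
    rw [Units.val_mul, Units.val_mul, ← Quaternion.re_add, ← add_mul,
      add_inv_eq (hG.norm_eq_one a ha), har, Quaternion.coe_mul_eq_smul, Quaternion.re_smul, hbr]
    norm_num
  have h1 : ((a * b : ℍˣ) : ℍ).re ≠ 0 := fun h => by
    have := hG.re_mul_eq_zero hno hai (G.mul_mem ha hb) hair h
    rw [Units.val_mul, Units.inv_mul_cancel_left, hbr] at this
    norm_num at this
  have h2 : ((a⁻¹ * b : ℍˣ) : ℍ).re ≠ 0 := fun h => by
    have := hG.re_mul_eq_zero hno ha (G.mul_mem hai hb) har h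
    rw [Units.val_mul, Units.mul_inv_cancel_left, hbr] at this
    norm_num at this
  rcases hG.re_cases (G.mul_mem ha hb) with h | h | h | h | h
  · exact (h1 h).elim
  · exact (h2 (by linarith)).elim
  · left
    have := hG.eq_one (G.mul_mem hai hb) (by linarith)
    rwa [inv_mul_eq_one, eq_comm] at this
  · right
    exact eq_inv_of_mul_eq_one_right h
  · rw [h] at hsum
    have h3 : ((a⁻¹ * b : ℍˣ) : ℍ).re = 3 / 2 := by
      simp at hsum ⊢
      linarith
    rcases hG.re_cases (G.mul_mem hai hb) with h | h | h | h | h <;> rw [h] at h3 <;>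
      norm_num at h3

end IsCrystallographic

/-! ### Conjugation of finite groups of quaternions -/

/-- Any two anticommuting imaginary units are simultaneously conjugate to `i` and `j`. -/
theorem exists_conj_eq {u w : ℍ} (hu : u * u = -1) (hw : w * w = -1) (huw : u * w = -(w * u)) :
    ∃ c : ℍ, c ≠ 0 ∧ c * u = qi * c ∧ c * w = qj * c := by
  have hqi0 : qi ≠ 0 := fun h => by simpa using congrArg QuaternionAlgebra.imI h
  have hqj0 : qj ≠ 0 := fun h => by simpa using congrArg QuaternionAlgebra.imJ h
  obtain ⟨c, hc0, hcu⟩ : ∃ c : ℍ, c ≠ 0 ∧ c * u = qi * c := by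
    by_cases h : 1 - qi * u = 0
    · have hu' : u = -qi := by
        have := congrArg (qi * ·) (sub_eq_zero.1 h)
        simp only [mul_one, ← mul_assoc, qi_mul_qi] at this
        rw [this]
        simp
      exact ⟨qj, hqj0, by rw [hu', mul_neg, qi_mul_qj]⟩
    · refine ⟨_, h, ?_⟩
      rw [sub_mul, mul_sub, mul_assoc, hu, ← mul_assoc qi qi, qi_mul_qi]
      simp [add_comm]
  let w' := c * w * c⁻¹
  have hw'c : w' * c = c * w := by simp only [w', mul_assoc, inv_mul_cancel₀ hc0, mul_one]
  have hw' : w' * w' = -1 := by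
    calc w' * w' = c * (w * w) * c⁻¹ := by simp only [w', mul_assoc, inv_mul_cancel_left₀ hc0]
      _ = -1 := by rw [hw, mul_neg, mul_one, neg_mul, mul_inv_cancel₀ hc0]
  have hiw' : w' * qi = -(qi * w') := by
    rw [← mul_left_inj' hc0, neg_mul, mul_assoc, ← hcu, ← mul_assoc, hw'c, mul_assoc qi, hw'c,
      ← mul_assoc, ← hcu, mul_assoc, mul_assoc, huw, mul_neg, neg_neg]
  obtain ⟨d, hd0, hdi, hdw⟩ : ∃ d : ℍ, d ≠ 0 ∧ d * qi = qi * d ∧ d * w' = qj * d := by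
    by_cases h : 1 - qj * w' = 0
    · have hw'j : w' = -qj := by
        have := congrArg (qj * ·) (sub_eq_zero.1 h)
        simp only [mul_one, ← mul_assoc, qj_mul_qj] at this
        rw [this]
        simp
      exact ⟨qi, hqi0, rfl, by rw [hw'j, mul_neg, qi_mul_qj, neg_neg]⟩
    · refine ⟨_, h, ?_, ?_⟩
      · rw [sub_mul, mul_sub, mul_assoc, hiw', ← mul_assoc qi qj, qi_mul_qj]
        simp [mul_assoc]
      · rw [sub_mul, mul_sub, mul_assoc, hw', ← mul_assoc qj qj, qj_mul_qj]
        simp [add_comm]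
  refine ⟨d * c, mul_ne_zero hd0 hc0, ?_, ?_⟩
  · rw [mul_assoc, hcu, ← mul_assoc, hdi, mul_assoc]
  · rw [mul_assoc, ← hw'c, ← mul_assoc, hdw, mul_assoc]

theorem eq_conj_of_mul_eq {c : ℍ} (hc : c ≠ 0) {u w : ℍˣ} (h : c * u = w * c) :
    MulAut.conj (Units.mk0 c hc) u = w := by
  rw [MulAut.conj_apply, mul_inv_eq_iff_eq_mul]
  exact Units.ext h

theorem anticommute_of_re_eq_zero {u w : ℍ} (hu : u.re = 0) (hw : w.re = 0)
    (huw : (u * w).re = 0) : u * w = -(w * u) := by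
  simp [hu, hw] at huw
  ext <;> simp [hu, hw] <;> linarith

theorem IsCrystallographic.map_conj {G : Subgroup ℍˣ} (hG : IsCrystallographic G) (c : ℍˣ) :
    IsCrystallographic (G.map (MulAut.conj c).toMonoidHom) where
  norm_eq_one := by
    rintro _ ⟨u, hu, rfl⟩
    have := hG.norm_eq_one u hu
    simp [this]
  exists_two_mul_re := by
    rintro _ ⟨u, hu, rfl⟩
    obtain ⟨n, hn⟩ := hG.exists_two_mul_re u hu
    refine ⟨n, ?_⟩
    change 2 * ((c * u * c⁻¹ : ℍˣ) : ℍ).re = n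
    rw [Units.val_mul, re_mul_comm, Units.val_mul, Units.inv_mul_cancel_left, hn]
  neg_one_mem := ⟨-1, hG.neg_one_mem, by simp⟩

/-! ### The classification -/

/-- `i` as a unit. -/
noncomputable def unitI : ℍˣ := ⟨qi, -qi, by simp [qi_mul_qi], by simp [qi_mul_qi]⟩

/-- `j` as a unit. -/
noncomputable def unitJ : ℍˣ := ⟨qj, -qj, by simp [qj_mul_qj], by simp [qj_mul_qj]⟩

/-- `ω` as a unit. -/
noncomputable def unitOmega : ℍˣ :=
  ⟨qomega, star qomega, by ext <;> simp <;> norm_num, by ext <;> simp <;> norm_num⟩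

@[simp] theorem val_unitI : (unitI : ℍ) = qi := rfl
@[simp] theorem val_unitJ : (unitJ : ℍ) = qj := rfl
@[simp] theorem val_unitOmega : (unitOmega : ℍ) = qomega := rfl
theorem val_inv_unitOmega : ((unitOmega⁻¹ : ℍˣ) : ℍ) = star qomega := rfl

theorem twoD_eq_closure (n : ℕ) : twoD n = Subgroup.closure {expUnit n, unitJ} := by
  rw [twoD]
  congr 1
  ext u
  simp only [Set.mem_insert_iff, Set.mem_singleton_iff, Set.mem_ofPred_eq, Units.ext_iff]
  rfl

theorem expUnit_two : expUnit 2 = unitI := Units.ext (by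
  change sliceExp (Real.pi / (2 : ℕ)) qi = qi
  rw [Nat.cast_two, sliceExp_pi_div_two])

theorem twoD_two_eq_closure : twoD 2 = Subgroup.closure {unitI, unitJ} := by
  rw [twoD_eq_closure, expUnit_two]

theorem twoT_eq_closure : twoT = Subgroup.closure {unitI, unitOmega} := by
  rw [twoT]
  congr 1
  ext u
  simp only [Set.mem_insert_iff, Set.mem_singleton_iff, Set.mem_ofPred_eq, Units.ext_iff]
  rfl

theorem unitI_mem_twoT : unitI ∈ twoT := by
  rw [twoT_eq_closure]
  exact Subgroup.subset_closure (by simp)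

theorem unitOmega_mem_twoT : unitOmega ∈ twoT := by
  rw [twoT_eq_closure]
  exact Subgroup.subset_closure (by simp)

theorem unitJ_mem_twoT : unitJ ∈ twoT := by
  have : unitJ = unitOmega * unitI * unitOmega⁻¹ * unitI := by
    refine Units.ext ?_
    simp only [Units.val_mul, val_inv_unitOmega, val_unitI, val_unitJ, val_unitOmega]
    ext <;> simp <;> norm_num
  rw [this]
  exact mul_mem (mul_mem (mul_mem unitOmega_mem_twoT unitI_mem_twoT)
    (inv_mem unitOmega_mem_twoT)) unitI_mem_twoT

theorem neg_mem_of_unitI_mem {K : Subgroup ℍˣ} (hI : unitI ∈ K) {u : ℍˣ} (hu : u ∈ K) :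
    -u ∈ K := by
  have : unitI * unitI = -1 := Units.ext (by simp [qi_mul_qi])
  rw [← neg_one_mul, ← this]
  exact mul_mem (mul_mem hI hI) hu

/-- Up to right multiplication by elements of `⟨i, j⟩`, the quaternions `(-1 ± i ± j ± k) / 2` are
`ω` and its inverse. -/
theorem exists_eq_unitOmega_mul {K : Subgroup ℍˣ} (hI : unitI ∈ K) (hJ : unitJ ∈ K) {h : ℍˣ}
    (h0 : (h : ℍ).re = -(1 / 2)) (h1 : (h : ℍ).imI = 1 / 2 ∨ (h : ℍ).imI = -(1 / 2))
    (h2 : (h : ℍ).imJ = 1 / 2 ∨ (h : ℍ).imJ = -(1 / 2))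
    (h3 : (h : ℍ).imK = 1 / 2 ∨ (h : ℍ).imK = -(1 / 2)) :
    ∃ s ∈ K, h = unitOmega * s ∨ h = unitOmega⁻¹ * s := by
  have hK := mul_mem hI hJ
  have hI' := neg_mem_of_unitI_mem hI hI
  have hJ' := neg_mem_of_unitI_mem hI hJ
  have hK' := neg_mem_of_unitI_mem hI hK
  have key : ∀ s : ℍˣ, (h : ℍ) = qomega * s → h = unitOmega * s := fun s hs => Units.ext hs
  have key' : ∀ s : ℍˣ, (h : ℍ) = star qomega * s → h = unitOmega⁻¹ * s := fun s hs => Units.ext hs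
  rcases h1 with h1 | h1 <;> rcases h2 with h2 | h2 <;> rcases h3 with h3 | h3
  · exact ⟨_, K.one_mem, Or.inl (key _ (by ext <;> norm_num [h0, h1, h2, h3]))⟩
  · exact ⟨_, hI', Or.inr (key' _ (by ext <;> norm_num [h0, h1, h2, h3]))⟩
  · exact ⟨_, hK', Or.inr (key' _ (by ext <;> norm_num [h0, h1, h2, h3]))⟩
  · exact ⟨_, hK, Or.inl (key _ (by ext <;> norm_num [h0, h1, h2, h3]))⟩
  · exact ⟨_, hJ', Or.inr (key' _ (by ext <;> norm_num [h0, h1, h2, h3]))⟩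
  · exact ⟨_, hI, Or.inl (key _ (by ext <;> norm_num [h0, h1, h2, h3]))⟩
  · exact ⟨_, hJ, Or.inl (key _ (by ext <;> norm_num [h0, h1, h2, h3]))⟩
  · exact ⟨_, K.one_mem, Or.inr (key' _ (by ext <;> norm_num [h0, h1, h2, h3]))⟩

theorem mem_iff_unitOmega_mem {K : Subgroup ℍˣ} (hI : unitI ∈ K) (hJ : unitJ ∈ K) {h : ℍˣ}
    (h0 : (h : ℍ).re = 1 / 2 ∨ (h : ℍ).re = -(1 / 2))
    (h1 : (h : ℍ).imI = 1 / 2 ∨ (h : ℍ).imI = -(1 / 2))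
    (h2 : (h : ℍ).imJ = 1 / 2 ∨ (h : ℍ).imJ = -(1 / 2))
    (h3 : (h : ℍ).imK = 1 / 2 ∨ (h : ℍ).imK = -(1 / 2)) : h ∈ K ↔ unitOmega ∈ K := by
  have hneg : ∀ {u : ℍˣ}, -u ∈ K ↔ u ∈ K := fun {u} =>
    ⟨fun hu => by simpa using neg_mem_of_unitI_mem hI hu, neg_mem_of_unitI_mem hI⟩
  have hmem : ∀ {u : ℍˣ}, (∃ s ∈ K, u = unitOmega * s ∨ u = unitOmega⁻¹ * s) →
      (u ∈ K ↔ unitOmega ∈ K) := by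
    rintro u ⟨s, hs, rfl | rfl⟩
    · rw [K.mul_mem_cancel_right hs]
    · rw [K.mul_mem_cancel_right hs, inv_mem_iff]
  have hflip : ∀ {x : ℝ}, x = 1 / 2 ∨ x = -(1 / 2) → -x = 1 / 2 ∨ -x = -(1 / 2) := by
    rintro x (rfl | rfl) <;> norm_num
  rcases h0 with h0 | h0
  · rw [← hneg]
    refine hmem (exists_eq_unitOmega_mul hI hJ ?_ ?_ ?_ ?_)
    · rw [Units.val_neg, Quaternion.re_neg, h0]
    · rw [Units.val_neg, Quaternion.imI_neg]; exact hflip h1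
    · rw [Units.val_neg, Quaternion.imJ_neg]; exact hflip h2
    · rw [Units.val_neg, Quaternion.imK_neg]; exact hflip h3
  · exact hmem (exists_eq_unitOmega_mul hI hJ h0 h1 h2 h3)

theorem nonempty_mulEquiv_twoC {G : Subgroup ℍˣ} {g : ℍˣ} {n : ℕ}
    (hgG : G = Subgroup.zpowers g)
    (hg : orderOf g = orderOf (expUnit n)) : Nonempty (G ≃* twoC n) := by
  rw [hgG, twoC_eq_zpowers]
  exact ⟨mulEquivOfCyclicCardEq (by rw [Nat.card_zpowers, Nat.card_zpowers, hg])⟩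

namespace IsCrystallographic

variable {G : Subgroup ℍˣ} (hG : IsCrystallographic G)
include hG

theorem re_mul_sq_le_of_notMem {K : Subgroup ℍˣ} (hI : unitI ∈ K) {u x : ℍˣ} (hu : u ∈ G)
    (hx : x ∈ G) (hxK : x ∈ K) (huK : u ∉ K) : ((u : ℍ) * x).re ^ 2 ≤ 1 / 4 := by
  rw [← Units.val_mul]
  rcases hG.re_cases (G.mul_mem hu hx) with h | h | h | h | h
  · rw [h]; norm_num
  · rw [h]; norm_num
  · rw [h]; norm_num
  · refine absurd ?_ huK
    rw [← K.mul_mem_cancel_right hxK, h]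
    exact K.one_mem
  · refine absurd ?_ huK
    rw [← K.mul_mem_cancel_right hxK, h]
    exact neg_mem_of_unitI_mem hI K.one_mem

/-- A group that contains the quaternion group `⟨i, j⟩` is the quaternion group or the binary
tetrahedral group: the coordinates of an element are real parts of elements of the group. -/
theorem eq_twoD_two_or_eq_twoT (hI : unitI ∈ G) (hJ : unitJ ∈ G) : G = twoD 2 ∨ G = twoT := by
  have hI2 : unitI ∈ twoD 2 := by
    rw [twoD_two_eq_closure]
    exact Subgroup.subset_closure (by simp)
  have hJ2 : unitJ ∈ twoD 2 := by
    rw [twoD_two_eq_closure]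
    exact Subgroup.subset_closure (by simp)
  have hle : twoD 2 ≤ G := by
    rw [twoD_two_eq_closure, Subgroup.closure_le]
    rintro _ (rfl | rfl) <;> assumption
  have hhalf : ∀ u ∈ G, u ∉ twoD 2 → ((u : ℍ).re = 1 / 2 ∨ (u : ℍ).re = -(1 / 2)) ∧
      ((u : ℍ).imI = 1 / 2 ∨ (u : ℍ).imI = -(1 / 2)) ∧
      ((u : ℍ).imJ = 1 / 2 ∨ (u : ℍ).imJ = -(1 / 2)) ∧
      ((u : ℍ).imK = 1 / 2 ∨ (u : ℍ).imK = -(1 / 2)) := by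
    intro u hu huK
    have hn := norm_sq_eq (u : ℍ)
    rw [hG.norm_eq_one u hu] at hn
    have e0 := hG.re_mul_sq_le_of_notMem hI2 hu G.one_mem (one_mem _) huK
    have e1 := hG.re_mul_sq_le_of_notMem hI2 hu hI hI2 huK
    have e2 := hG.re_mul_sq_le_of_notMem hI2 hu hJ hJ2 huK
    have e3 := hG.re_mul_sq_le_of_notMem hI2 hu (mul_mem hI hJ) (mul_mem hI2 hJ2) huK
    simp only [Units.val_one, mul_one, Units.val_mul, val_unitI, val_unitJ, Quaternion.re_mul,
      Quaternion.imI_mul, Quaternion.imJ_mul, Quaternion.imK_mul, qi_re, qi_imI, qi_imJ, qi_imK,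
      qj_re, qj_imI, qj_imJ, qj_imK, mul_zero, zero_sub, sub_zero, add_zero, zero_add, neg_sq,
      sub_self] at e0 e1 e2 e3
    have hsq : ∀ {x : ℝ}, x ^ 2 = 1 / 4 → x = 1 / 2 ∨ x = -(1 / 2) := fun {x} hx =>
      sq_eq_sq_iff_eq_or_eq_neg.1 (by rw [hx]; norm_num)
    exact ⟨hsq (by linarith), hsq (by linarith), hsq (by linarith), hsq (by linarith)⟩
  by_cases hG2 : G ≤ twoD 2
  · exact Or.inl (le_antisymm hG2 hle)
  · right
    obtain ⟨h, hhG, hh2⟩ := SetLike.not_le_iff_exists.1 hG2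
    obtain ⟨h0, h1, h2, h3⟩ := hhalf h hhG hh2
    have hω : unitOmega ∈ G := (mem_iff_unitOmega_mem hI hJ h0 h1 h2 h3).1 hhG
    refine le_antisymm (fun u hu => ?_) ?_
    · by_cases hu2 : u ∈ twoD 2
      · have : twoD 2 ≤ twoT := by
          rw [twoD_two_eq_closure, Subgroup.closure_le]
          rintro _ (rfl | rfl)
          · exact unitI_mem_twoT
          · exact unitJ_mem_twoT
        exact this hu2
      · obtain ⟨h0, h1, h2, h3⟩ := hhalf u hu hu2
        exact (mem_iff_unitOmega_mem unitI_mem_twoT unitJ_mem_twoT h0 h1 h2 h3).2 unitOmega_mem_twoT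
    · rw [twoT_eq_closure, Subgroup.closure_le]
      rintro _ (rfl | rfl) <;> assumption

/-- If no two pure elements are orthogonal, the elements that are not pure are powers of any given
element of order 6, because `-1` is one. -/
theorem mem_of_re_ne_zero (hno : ∀ p ∈ G, ∀ w ∈ G, (p : ℍ).re = 0 → (w : ℍ).re = 0 →
    ((p : ℍ) * w).re ≠ 0) {K : Subgroup ℍˣ} {a u : ℍˣ} (ha : a ∈ G) (har : (a : ℍ).re = 1 / 2)
    (haK : a ∈ K) (hu : u ∈ G) (hur : (u : ℍ).re ≠ 0) : u ∈ K := by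
  have hnegone : -1 ∈ K := by
    have haa : (a : ℍ) * a = a - 1 := by
      rw [mul_self_eq_of_norm (hG.norm_eq_one a ha), har]
      norm_num
    have : a * a * a = -1 := Units.ext (by
      rw [Units.val_mul, Units.val_mul, haa, sub_mul, haa]
      simp)
    rw [← this]
    exact mul_mem (mul_mem haK haK) haK
  have hpos : ∀ u ∈ G, (u : ℍ).re = 1 / 2 → u ∈ K := by
    intro u hu hur
    rcases hG.eq_or_eq_inv hno ha hu har hur with rfl | rfl
    · exact haK
    · exact inv_mem haK
  rcases hG.re_cases hu with h | h | h | rfl | rfl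
  · exact absurd h hur
  · exact hpos u hu h
  · rw [← neg_neg u, ← neg_one_mul]
    exact mul_mem hnegone (hpos _ (hG.neg_mem hu)
      (by rw [Units.val_neg, Quaternion.re_neg, h, neg_neg]))
  · exact one_mem _
  · exact hnegone

/-- If no two pure elements are orthogonal and there are elements `a` of order 6 and `p` of order 4,
then these generate the group. -/
theorem eq_closure_pair (hno : ∀ p ∈ G, ∀ w ∈ G, (p : ℍ).re = 0 → (w : ℍ).re = 0 →
    ((p : ℍ) * w).re ≠ 0) {a p : ℍˣ} (ha : a ∈ G) (hp : p ∈ G) (har : (a : ℍ).re = 1 / 2)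
    (hpr : (p : ℍ).re = 0) : G = Subgroup.closure {a, p} := by
  set K := Subgroup.closure {a, p}
  have haK : a ∈ K := Subgroup.subset_closure (by simp)
  have hpK : p ∈ K := Subgroup.subset_closure (by simp)
  have hKG : K ≤ G := by
    rw [Subgroup.closure_le]
    rintro _ (rfl | rfl) <;> assumption
  have hmem : ∀ u ∈ G, (u : ℍ).re ≠ 0 → u ∈ K := fun u hu hur =>
    hG.mem_of_re_ne_zero hno ha har haK hu hur
  refine le_antisymm (fun u hu => ?_) hKG
  by_cases hur : (u : ℍ).re = 0
  · have := hmem _ (G.mul_mem hp hu) (hno p hp u hu hpr hur)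
    rwa [K.mul_mem_cancel_left hpK] at this
  · exact hmem u hu hur

theorem nonempty_mulEquiv_twoD_three (hno : ∀ p ∈ G, ∀ w ∈ G, (p : ℍ).re = 0 → (w : ℍ).re = 0 →
    ((p : ℍ) * w).re ≠ 0) {a p : ℍˣ} (ha : a ∈ G) (hp : p ∈ G) (har : (a : ℍ).re = 1 / 2)
    (hpr : (p : ℍ).re = 0) : Nonempty (G ≃* twoD 3) := by
  have haa : (a : ℍ) * a = a - 1 := by
    rw [mul_self_eq_of_norm (hG.norm_eq_one a ha), har]
    norm_num
  have hpp : (p : ℍ) * p = -1 := by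
    rw [mul_self_eq_of_norm (hG.norm_eq_one p hp), hpr]
    simp
  obtain ⟨I, hI, hIa⟩ := exists_sliceExp_eq haa
  have hI2 : I * I = -1 := by rw [← sq]; exact hI
  have h3 : √3 ≠ 0 := by positivity
  have hIr : I.re = 0 := by
    have h := har
    rw [← hIa, sliceExp_pi_div_three, Quaternion.re_add, Quaternion.re_coe, Quaternion.re_smul,
      smul_eq_mul, add_eq_left] at h
    exact (mul_eq_zero.1 h).resolve_left (by positivity)
  have hIp : (I * p).re = 0 := by
    have h := hG.re_mul_eq_zero hno ha hp har hpr
    rw [← hIa, sliceExp_pi_div_three, add_mul, Quaternion.re_add, Quaternion.coe_mul_eq_smul,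
      Quaternion.re_smul, hpr, smul_mul_assoc, Quaternion.re_smul, smul_zero, zero_add] at h
    exact (mul_eq_zero.1 h).resolve_left (by positivity)
  obtain ⟨c, hc, hcI, hcp⟩ := exists_conj_eq hI2 hpp (anticommute_of_re_eq_zero hIr hpr hIp)
  have h1 : MulAut.conj (Units.mk0 c hc) a = expUnit 3 := eq_conj_of_mul_eq hc (by
    change c * (a : ℍ) = sliceExp (Real.pi / (3 : ℕ)) qi * c
    rw [← hIa, Nat.cast_ofNat, sliceExp_pi_div_three, sliceExp_pi_div_three, mul_add, add_mul,
      mul_smul_comm, smul_mul_assoc, hcI, Quaternion.coe_mul_eq_smul, Quaternion.mul_coe_eq_smul])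
  have h2 : MulAut.conj (Units.mk0 c hc) p = unitJ := eq_conj_of_mul_eq hc hcp
  have hmap : G.map (MulAut.conj (Units.mk0 c hc)).toMonoidHom = twoD 3 := by
    rw [hG.eq_closure_pair hno ha hp har hpr, MonoidHom.map_closure, twoD_eq_closure,
      Set.image_pair]
    simp only [MulEquiv.toMonoidHom_eq_coe, MonoidHom.coe_coe, h1, h2]
  rw [← hmap]
  exact ⟨(MulAut.conj (Units.mk0 c hc)).subgroupMap G⟩

theorem nonempty_mulEquiv_of_orthogonal {p w : ℍˣ} (hp : p ∈ G) (hw : w ∈ G)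
    (hpr : (p : ℍ).re = 0) (hwr : (w : ℍ).re = 0) (hpw : ((p : ℍ) * w).re = 0) :
    Nonempty (G ≃* twoD 2) ∨ Nonempty (G ≃* twoT) := by
  have hsq : ∀ {u : ℍˣ}, u ∈ G → (u : ℍ).re = 0 → (u : ℍ) * u = -1 := by
    intro u hu hur
    rw [mul_self_eq_of_norm (hG.norm_eq_one u hu), hur]
    simp
  obtain ⟨c, hc, hcp, hcw⟩ := exists_conj_eq (hsq hp hpr) (hsq hw hwr)
    (anticommute_of_re_eq_zero hpr hwr hpw)
  have e := (MulAut.conj (Units.mk0 c hc)).subgroupMap G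
  rcases (hG.map_conj (Units.mk0 c hc)).eq_twoD_two_or_eq_twoT
    ⟨p, hp, eq_conj_of_mul_eq hc hcp⟩ ⟨w, hw, eq_conj_of_mul_eq hc hcw⟩ with h | h
  · left
    rw [← h]
    exact ⟨e⟩
  · right
    rw [← h]
    exact ⟨e⟩

/-- A crystallographic group of quaternions other than `{±1}` is one of five groups. -/
theorem classification (hne : ∃ u ∈ G, u ≠ 1 ∧ u ≠ -1) :
    Nonempty (G ≃* twoC 3) ∨ Nonempty (G ≃* twoC 2) ∨ Nonempty (G ≃* twoD 2) ∨
      Nonempty (G ≃* twoD 3) ∨ Nonempty (G ≃* twoT) := by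
  by_cases hno : ∀ p ∈ G, ∀ w ∈ G, (p : ℍ).re = 0 → (w : ℍ).re = 0 → ((p : ℍ) * w).re ≠ 0
  swap
  · push Not at hno
    obtain ⟨p, hp, w, hw, hpr, hwr, hpw⟩ := hno
    have := hG.nonempty_mulEquiv_of_orthogonal hp hw hpr hwr hpw
    tauto
  by_cases hhalf : ∃ a ∈ G, (a : ℍ).re = 1 / 2
  · obtain ⟨a, ha, har⟩ := hhalf
    by_cases hpure : ∃ p ∈ G, (p : ℍ).re = 0
    · obtain ⟨p, hp, hpr⟩ := hpure
      have := hG.nonempty_mulEquiv_twoD_three hno ha hp har hpr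
      tauto
    · left
      have haa : (a : ℍ) * a = a - 1 := by
        rw [mul_self_eq_of_norm (hG.norm_eq_one a ha), har]
        norm_num
      refine nonempty_mulEquiv_twoC (g := a) (le_antisymm (fun u hu => ?_)
        (Subgroup.zpowers_le.2 ha)) ?_
      · exact hG.mem_of_re_ne_zero hno ha har (Subgroup.mem_zpowers a) hu
          fun h => hpure ⟨u, hu, h⟩
      · rw [orderOf_eq_six_iff.2 haa, orderOf_expUnit_three]
  · right
    left
    have hre : ∀ u ∈ G, (u : ℍ).re = 0 ∨ u = 1 ∨ u = -1 := by
      intro u hu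
      rcases hG.re_cases hu with h | h | h | h | h
      · exact Or.inl h
      · exact absurd ⟨u, hu, h⟩ hhalf
      · exact absurd ⟨-u, hG.neg_mem hu, by rw [Units.val_neg, Quaternion.re_neg, h, neg_neg]⟩ hhalf
      · exact Or.inr (Or.inl h)
      · exact Or.inr (Or.inr h)
    obtain ⟨p, hp, hp1, hp2⟩ := hne
    have hpr : (p : ℍ).re = 0 := by
      have := hre p hp
      tauto
    have hpp : (p : ℍ) * p = -1 := by
      rw [mul_self_eq_of_norm (hG.norm_eq_one p hp), hpr]
      simp
    have hpZ := Subgroup.mem_zpowers p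
    have hnegone : -1 ∈ Subgroup.zpowers p := by
      rw [← show p * p = -1 from Units.ext hpp]
      exact mul_mem hpZ hpZ
    refine nonempty_mulEquiv_twoC (g := p) (le_antisymm (fun u hu => ?_)
      (Subgroup.zpowers_le.2 hp)) ?_
    · rcases hre u hu with h | rfl | rfl
      · rw [← Subgroup.mul_mem_cancel_left _ hpZ]
        rcases hre _ (G.mul_mem hp hu) with h' | h' | h'
        · exact absurd h' (hno p hp u hu hpr h)
        · rw [h']
          exact one_mem _
        · rw [h']
          exact hnegone
      · exact one_mem _
      · exact hnegone
    · rw [orderOf_eq_four_iff.2 hpp, orderOf_expUnit_two]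

end IsCrystallographic

theorem ne_one_and_ne_neg_one_of_two_lt_orderOf {u : ℍˣ} (hu : 2 < orderOf u) :
    u ≠ 1 ∧ u ≠ -1 := by
  constructor
  · rintro rfl
    rw [orderOf_one] at hu
    omega
  · rintro rfl
    have := orderOf_le_of_pow_eq_one (x := (-1 : ℍˣ)) (n := 2) (by norm_num) (by simp)
    omega

theorem exists_ne_of_autIso {L : AddSubgroup ℍ} {K : Subgroup ℍˣ} (h : AutIso L K) {g : ℍˣ}
    (hg : g ∈ K) (hord : 2 < orderOf g) : ∃ u ∈ unitStabilizer L, u ≠ 1 ∧ u ≠ -1 := by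
  obtain ⟨e⟩ := h
  let x := ((unitStabilizerEquiv L).trans e).symm ⟨g, hg⟩
  have hx : 2 < orderOf (x : ℍˣ) := by
    rw [Subgroup.orderOf_coe, MulEquiv.orderOf_eq, Subgroup.orderOf_mk]
    exact hord
  exact ⟨x, x.2, ne_one_and_ne_neg_one_of_two_lt_orderOf hx⟩

theorem exists_ne_iff_autIso {L : AddSubgroup ℍ} (hL : IsRankFourLattice L) :
    (∃ u ∈ unitStabilizer L, u ≠ 1 ∧ u ≠ -1) ↔ IsCyclicTorus L ∨ IsCyclicDihedralTorus L ∨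
      IsEightDihedralTorus L ∨ IsTwelveDihedralTorus L ∨ IsTetrahedralTorus L := by
  have e := (unitStabilizerEquiv L).symm
  constructor
  · intro h
    rcases (isCrystallographic_unitStabilizer hL).classification h with h | h | h | h | h
    · exact Or.inl (h.map e.trans)
    · exact Or.inr (Or.inl (h.map e.trans))
    · exact Or.inr (Or.inr (Or.inl (h.map e.trans)))
    · exact Or.inr (Or.inr (Or.inr (Or.inl (h.map e.trans))))
    · exact Or.inr (Or.inr (Or.inr (Or.inr (h.map e.trans))))
  · have hD : ∀ n, expUnit n ∈ twoD n := fun n => by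
      rw [twoD_eq_closure]
      exact Subgroup.subset_closure (by simp)
    have hC : ∀ n, expUnit n ∈ twoC n := fun n => by
      rw [twoC_eq_zpowers]
      exact Subgroup.mem_zpowers _
    rintro (h | h | h | h | h)
    · exact exists_ne_of_autIso h (hC 3) (by rw [orderOf_expUnit_three]; norm_num)
    · exact exists_ne_of_autIso h (hC 2) (by rw [orderOf_expUnit_two]; norm_num)
    · exact exists_ne_of_autIso h (hD 2) (by rw [orderOf_expUnit_two]; norm_num)
    · exact exists_ne_of_autIso h (hD 3) (by rw [orderOf_expUnit_three]; norm_num)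
    · exact exists_ne_of_autIso h unitI_mem_twoT
        (by rw [← expUnit_two, orderOf_expUnit_two]; norm_num)

/-- An element other than `±1` has order 4, or it or its negative has order 6. -/
theorem exists_ne_iff_exists_root {L : AddSubgroup ℍ} (hL : IsRankFourLattice L) :
    (∃ u ∈ unitStabilizer L, u ≠ 1 ∧ u ≠ -1) ↔ (∃ u ∈ unitStabilizer L, (u : ℍ) * u = -1) ∨
      ∃ u ∈ unitStabilizer L, (u : ℍ) * u = u - 1 := by
  have hG := isCrystallographic_unitStabilizer hL
  have hhalf : ∀ u ∈ unitStabilizer L, (u : ℍ).re = 1 / 2 → (u : ℍ) * u = u - 1 := by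
    intro u hu h
    rw [mul_self_eq_of_norm (hG.norm_eq_one u hu), h]
    norm_num
  constructor
  · rintro ⟨u, hu, hu1, hu2⟩
    rcases hG.re_cases hu with h | h | h | h | h
    · refine Or.inl ⟨u, hu, ?_⟩
      rw [mul_self_eq_of_norm (hG.norm_eq_one u hu), h]
      simp
    · exact Or.inr ⟨u, hu, hhalf u hu h⟩
    · exact Or.inr ⟨-u, hG.neg_mem hu, hhalf _ (hG.neg_mem hu)
        (by rw [Units.val_neg, Quaternion.re_neg, h, neg_neg])⟩
    · exact absurd h hu1
    · exact absurd h hu2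
  · have key := fun (u : ℍˣ) => ne_one_and_ne_neg_one_of_two_lt_orderOf (u := u)
    rintro (⟨u, hu, h⟩ | ⟨u, hu, h⟩)
    · exact ⟨u, hu, key u (by rw [orderOf_eq_four_iff.2 h]; norm_num)⟩
    · exact ⟨u, hu, key u (by rw [orderOf_eq_six_iff.2 h]; norm_num)⟩

end QTorus

theorem theorem1p1 (L : AddSubgroup ℍ) (hL : QTorus.IsRankFourLattice L) :
    ((QTorus.autTorus L : Set (Equiv.Perm ℍ)) ≠ QTorus.plusMinusOne ↔
      QTorus.HasHarmonicModulus L ∨ QTorus.HasEquianharmonicModulus L) ∧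
    (QTorus.HasHarmonicModulus L ↔ QTorus.AutContains L (QTorus.twoC 2)) ∧
    (QTorus.HasEquianharmonicModulus L ↔ QTorus.AutContains L (QTorus.twoC 3)) ∧
    ((QTorus.autTorus L : Set (Equiv.Perm ℍ)) ≠ QTorus.plusMinusOne ↔
      QTorus.IsCyclicTorus L ∨ QTorus.IsCyclicDihedralTorus L ∨
      QTorus.IsEightDihedralTorus L ∨ QTorus.IsTwelveDihedralTorus L ∨
      QTorus.IsTetrahedralTorus L) := by
  rw [QTorus.autTorus_ne_plusMinusOne_iff, QTorus.autContains_twoC_two_iff,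
    QTorus.autContains_twoC_three_iff, QTorus.hasHarmonicModulus_iff hL,
    QTorus.hasEquianharmonicModulus_iff hL]
  exact ⟨QTorus.exists_ne_iff_exists_root hL, Iff.rfl, Iff.rfl, QTorus.exists_ne_iff_autIso hL⟩
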